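/- **Binary value principle modulo $p$.** There is a polynomial $Q$ with natural-number coefficients such that the following holds for every prime $p$, every $n\ge 0$ and every algebraic circuit $F(x_1,\dots,x_n)$ over $\mathbb{F}_p$ of total bit-size $s$. Put $b_p=\lfloor\log_2 p\rfloor+1$ and, for each $i$, let $x_{i,0},\dots,x_{i,b_p-1}$ be new variables. Then there is an $\mathrm{IPS}_{\mathbb{F}_p}$ proof of total bit-size at most $Q(s+\lfloor\log_2 p\rfloor)$, from the Boolean axioms $x_{i,j}^2-x_{i,j}$ ($1\le i\le n$, $0\le j<b_p$), of the polynomial $$F\bigl(\mathrm{VAL}_p(\overline{\mathrm{BIT}}_p(x_1)),\dots,\mathrm{VAL}_p(\overline{\mathrm{BIT}}_p(x_n))\bigr)-\mathrm{VAL}_p(\overline{\mathrm{BIT}}_p(F)).$$ *Circuits and IPS.* An algebraic circuit over a ring $R$ is a directed acyclic graph with an output gate, whose gates are variables, constants, binary products, linear combinations of any fan-in with wires labelled by elements of $R$, and inversions of syntactically constant gates with invertible value. Its total bit-size is the number of gates, plus the number of wires, plus the binary lengths of all constants that label gates or wires, elements of $\mathbb{F}_p$ being written as integers in $\{0,\dots,p-1\}$.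 An $\mathrm{IPS}_R$ proof of $G(\overline x)$ from polynomials $A_1,\dots,A_m$ is an algebraic circuit over $R$ that computes a polynomial $C(\overline x,y_1,\dots,y_m)$ with $C(\overline x,A_1,\dots,A_m)=G$ and $C(\overline x,\overline 0)=0$. *Values.* Boolean circuits are identified with polynomials through $\mathrm{alg}(x)=x$, $\mathrm{alg}(0)=0$, $\mathrm{alg}(1)=1$, $\mathrm{alg}(\neg\varphi)=1-\mathrm{alg}(\varphi)$, $\mathrm{alg}(\varphi\wedge\psi)=\mathrm{alg}(\varphi)\mathrm{alg}(\psi)$, $\mathrm{alg}(\varphi\vee\psi)=1-(1-\mathrm{alg}(\varphi))(1-\mathrm{alg}(\psi))$. For a vector $\overline z=(z_0,\dots,z_{b-1})$ of Boolean circuits, $\mathrm{VAL}_p(\overline z)=\sum_{i<b}2^i\,\mathrm{alg}(z_i)\in\mathbb{F}_p[x_{i,j}]$. *Arithmetic modulo $p$.* Let $\mathrm{ADD}$ and $\mathrm{PROD}$ be the ripple-carry adder and the shift-and-add multiplier, for unsigned binary numbers or, in the definition of $\mathrm{SUB}$, for two's complement. For an unsigned $b$-bit vector $\overline z$, let $\mathrm{LT}_i(\overline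 z)$ be the bitwise comparison circuit for $\overline z<2^ip$, and let $\mathrm{SUB}_i(\overline z)=\mathrm{ADD}(0\overline z,\mathrm{PROD}(-2^i,p))$ be the two's-complement circuit for $\overline z-2^ip$. Put $\overline z^{\,0}=\overline z$ and, for $1\le i\le b$ and $0\le j<b$, $$z^{\,i}_j=\bigl(\mathrm{LT}_{b-i}(\overline z^{\,i-1})\wedge z^{\,i-1}_j\bigr)\vee\bigl(\neg\mathrm{LT}_{b-i}(\overline z^{\,i-1})\wedge \mathrm{SUB}_{b-i}(\overline z^{\,i-1})_j\bigr).$$ Let $\overline{\mathrm{REM}}_p(\overline z)$ consist of the $b_p$ lowest bits of $\overline z^{\,b}$, and put $\overline{\mathrm{ADD}}_p=\overline{\mathrm{REM}}_p\circ\mathrm{ADD}$ and $\overline{\mathrm{PROD}}_p=\overline{\mathrm{REM}}_p\circ\mathrm{PROD}$ on pairs of unsigned $b_p$-bit vectors. *Bit extraction.* $\overline{\mathrm{BIT}}_p$ is defined along the gates of $F$: $\overline{\mathrm{BIT}}_p(x_i)=(x_{i,0},\dots,x_{i,b_p-1})$; for $\alpha\in\mathbb{F}_p$, $\overline{\mathrm{BIT}}_p(\alpha)$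 is the vector of the $b_p$ binary digits of $\alpha\in\{0,\dots,p-1\}$; $\overline{\mathrm{BIT}}_p(G\times H)=\overline{\mathrm{PROD}}_p(\overline{\mathrm{BIT}}_p(G),\overline{\mathrm{BIT}}_p(H))$; $\overline{\mathrm{BIT}}_p(G+H)=\overline{\mathrm{ADD}}_p(\overline{\mathrm{BIT}}_p(G),\overline{\mathrm{BIT}}_p(H))$. A linear combination $\sum_i c_iG_i$ is treated as the iterated sum $c_1G_1+(c_2G_2+\cdots)$, where the bits of $c_iG_i$ are those of $G_i$ if $c_i=1$ and those of the product $c_i\times G_i$ otherwise, and the empty sum is the constant $0$; an inversion gate is treated as the constant it computes. -/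

import Mathlib

/-! ## Algebraic circuits -/

namespace AlgCirc

/-- A gate of an algebraic circuit over `R` with variables in `V`, whose incoming wires start at
some of the `k` gates that precede it: a variable, a constant, a binary product, a linear
combination of arbitrary fan-in with its wires labelled by elements of `R`, or an inversion. -/
inductive Gate (R V : Type) (k : ℕ) : Type
  | var (v : V) : Gate R V k
  | const (c : R) : Gate R V k
  | mul (u w : Fin k) : Gate R V k
  | lin (l : List (R × Fin k)) : Gate R V k
  | inv (u : Fin k) : Gate R V k

/-- The gates of an acyclic circuit, listed in a topological order. A gate may be reused by any
number of later gates. -/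
inductive Gates (R V : Type) : ℕ → Type
  | nil : Gates R V 0
  | snoc {k : ℕ} (c : Gates R V k) (g : Gate R V k) : Gates R V (k + 1)

/-- A gate is syntactically constant if all the inputs it depends on are constants. -/
def Gate.SynConst {R V : Type} {k : ℕ} (s : Fin k → Prop) : Gate R V k → Prop
  | .var _ => False
  | .const _ => True
  | .mul u w => s u ∧ s w
  | .lin l => ∀ e ∈ l, s e.2
  | .inv u => s u

def Gates.SynConst {R V : Type} : {k : ℕ} → Gates R V k → Fin k → Prop
  | _, .nil => Fin.elim0
  | _, .snoc c g => Fin.snoc (α := fun _ => Prop) c.SynConst (g.SynConst c.SynConst)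

/-- The polynomial computed at a gate, from the polynomials `f` computed at its predecessors. -/
noncomputable def Gate.poly {R V : Type} [CommRing R] {k : ℕ} (f : Fin k → MvPolynomial V R) :
    Gate R V k → MvPolynomial V R
  | .var v => MvPolynomial.X v
  | .const c => MvPolynomial.C c
  | .mul u w => f u * f w
  | .lin l => (l.map fun e => MvPolynomial.C e.1 * f e.2).sum
  | .inv u => Ring.inverse (f u)

noncomputable def Gates.poly {R V : Type} [CommRing R] :
    {k : ℕ} → Gates R V k → Fin k → MvPolynomial V R
  | _, .nil => Fin.elim0
  | _, .snoc c g => Fin.snoc (α := fun _ => MvPolynomial V R) c.poly (g.poly c.poly)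

/-- Inversion is allowed only at syntactically constant gates whose value is invertible. -/
def Gate.Admissible {R V : Type} [CommRing R] {k : ℕ} (c : Gates R V k) : Gate R V k → Prop
  | .inv u => c.SynConst u ∧ IsUnit (c.poly u)
  | _ => True

def Gates.Admissible {R V : Type} [CommRing R] : {k : ℕ} → Gates R V k → Prop
  | _, .nil => True
  | _, .snoc c g => c.Admissible ∧ g.Admissible c

/-- The contribution of a gate to the total bit-size: one for the gate, one for each incoming
wire, and the length of the binary representation of each constant that labels the gate or one of
its wires, elements of `𝔽_p` being written as elements of `{0, …, p - 1}`. -/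
def Gate.bitSize {p : ℕ} {V : Type} {k : ℕ} : Gate (ZMod p) V k → ℕ
  | .var _ => 1
  | .const c => 1 + c.val.size
  | .mul _ _ => 1 + 2
  | .lin l => 1 + (l.map fun e => 1 + e.1.val.size).sum
  | .inv _ => 1 + 1

def Gates.bitSize {p : ℕ} {V : Type} : {k : ℕ} → Gates (ZMod p) V k → ℕ
  | _, .nil => 0
  | _, .snoc c g => c.bitSize + g.bitSize

end AlgCirc

/-- An algebraic circuit over `R` with variables in `V` and one output gate. -/
structure AlgCircuit (R V : Type) [CommRing R] where
  numGates : ℕ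
  gates : AlgCirc.Gates R V numGates
  admissible : gates.Admissible
  out : Fin numGates

/-- The polynomial computed by a circuit. -/
noncomputable def AlgCircuit.poly {R V : Type} [CommRing R] (F : AlgCircuit R V) :
    MvPolynomial V R :=
  F.gates.poly F.out

/-- The total bit-size of a circuit over `𝔽_p`. -/
def AlgCircuit.bitSize {p : ℕ} {V : Type} (F : AlgCircuit (ZMod p) V) : ℕ :=
  F.gates.bitSize

/-! ## The Ideal Proof System -/

/-- `P` computes an IPS certificate `C(x, y)` of `G` from the polynomials `A a`; the variables `x`
are the `Sum.inl v` and the placeholder of `A a` is `Sum.inr a`. -/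
def IsIPSProof {R V K : Type} [CommRing R] (P : AlgCircuit R (V ⊕ K)) (A : K → MvPolynomial V R)
    (G : MvPolynomial V R) : Prop :=
  MvPolynomial.aeval (Sum.elim MvPolynomial.X A) P.poly = G ∧
  MvPolynomial.aeval (Sum.elim (MvPolynomial.X (R := R) (σ := V)) (fun _ : K => 0)) P.poly = 0

/-- The Boolean axioms `v ^ 2 - v`, one for each variable. -/
noncomputable def boolAxiom (R V : Type) [CommRing R] (v : V) : MvPolynomial V R :=
  MvPolynomial.X v ^ 2 - MvPolynomial.X v

/-! ## Boolean circuits and their algebraic translation -/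

/-- Boolean circuits over the basis `¬, ∧, ∨`, identified with their unfolding: below, only the
polynomial that a Boolean circuit is translated to matters, and never its size. -/
inductive BoolCircuit (V : Type) : Type
  | var (v : V) : BoolCircuit V
  | const (b : Bool) : BoolCircuit V
  | not (a : BoolCircuit V) : BoolCircuit V
  | and (a b : BoolCircuit V) : BoolCircuit V
  | or (a b : BoolCircuit V) : BoolCircuit V

namespace BoolCircuit

variable {V : Type}

/-- The algebraic translation. -/
noncomputable def alg (R : Type) [CommRing R] : BoolCircuit V → MvPolynomial V R
  | var v => MvPolynomial.X v
  | const b => if b then 1 else 0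
  | not a => 1 - a.alg R
  | and a b => a.alg R * b.alg R
  | or a b => 1 - (1 - a.alg R) * (1 - b.alg R)

def xor (a b : BoolCircuit V) : BoolCircuit V :=
  or (and a (not b)) (and (not a) b)

/-! ### Binary arithmetic

Bit vectors are lists of Boolean circuits, least significant bit first. -/

/-- The `i`-th bit of an unsigned number; `0` beyond its length. -/
def ubit (x : List (BoolCircuit V)) (i : ℕ) : BoolCircuit V :=
  x.getD i (const false)

/-- The sign bit, that is the last bit, of a number in two's complement. -/
def sign (x : List (BoolCircuit V)) : BoolCircuit V :=
  x.getLastD (const false)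

/-- The `i`-th bit of a number in two's complement; the sign bit is repeated beyond its length. -/
def sbit (x : List (BoolCircuit V)) (i : ℕ) : BoolCircuit V :=
  x.getD i (sign x)

/-- The carry into position `i` in the addition of two numbers in two's complement. -/
def CARRY (x y : List (BoolCircuit V)) : ℕ → BoolCircuit V
  | 0 => const false
  | i + 1 => or (and (sbit x i) (sbit y i)) (and (or (sbit x i) (sbit y i)) (CARRY x y i))

/-- Addition in two's complement. Two numbers of `k` bits have a sum of `k + 1` bits. -/
def ADD (x y : List (BoolCircuit V)) : List (BoolCircuit V) :=
  (List.range (max x.length y.length + 1)).map fun i =>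
    xor (xor (sbit x i) (sbit y i)) (CARRY x y i)

/-- Addition of unsigned numbers: a sign bit `0` is prepended to both, and the sign bit of the sum
is dropped. Two numbers of `k` bits have a sum of `k + 1` bits. -/
def ADDplus (x y : List (BoolCircuit V)) : List (BoolCircuit V) :=
  (ADD (x ++ [const false]) (y ++ [const false])).dropLast

/-- The sum of the first `i` summands `2 ^ j * y_j * x` of the product of two unsigned numbers.
Adding `2 ^ i * y_i * x` leaves the `i` lowest bits unchanged. -/
def PRODplusAux (x y : List (BoolCircuit V)) : ℕ → List (BoolCircuit V)
  | 0 => List.replicate x.length (const false)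
  | i + 1 => (PRODplusAux x y i).take i ++
      ADDplus ((PRODplusAux x y i).drop i) (x.map fun a => and a (ubit y i))

/-- Product of unsigned numbers by shifting and adding. Numbers of `k` and `l` bits have a product
of `k + l` bits. -/
def PRODplus (x y : List (BoolCircuit V)) : List (BoolCircuit V) :=
  PRODplusAux x y y.length

/-- If `s = 0`, the number `x` in two's complement; if `s = 1`, its opposite: all bits are
flipped and `1` is added. -/
def NEGIF (s : BoolCircuit V) (x : List (BoolCircuit V)) : List (BoolCircuit V) :=
  ADD (x.map fun a => xor a s) [s, const false]

/-- The absolute value of a number in two's complement. -/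
def ABS (x : List (BoolCircuit V)) : List (BoolCircuit V) :=
  NEGIF (sign x) x

/-- Product in two's complement: the product of the absolute values, with the appropriate sign. -/
def PROD (x y : List (BoolCircuit V)) : List (BoolCircuit V) :=
  NEGIF (xor (sign x) (sign y)) (PRODplus (ABS x) (ABS y) ++ [const false])

/-- The `b` lowest bits of a natural number, as constants. -/
def natBits (b n : ℕ) : List (BoolCircuit V) :=
  (List.range b).map fun i => const (n.testBit i)

/-- The bits of an integer in two's complement, as constants. -/
def intBits (a : ℤ) : List (BoolCircuit V) :=
  (List.range (a.natAbs.size + 1)).map fun i => const (a.testBit i)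

/-- Comparison of the `i` lowest bits of two unsigned numbers. -/
def LTaux (x y : List (BoolCircuit V)) : ℕ → BoolCircuit V
  | 0 => const false
  | i + 1 => or (and (not (ubit x i)) (ubit y i))
      (and (not (xor (ubit x i) (ubit y i))) (LTaux x y i))

/-- The circuit that decides `x < y` for unsigned numbers. -/
def LT (x y : List (BoolCircuit V)) : BoolCircuit V :=
  LTaux x y (max x.length y.length)

/-- The circuit that decides `x < 2 ^ i * p` for an unsigned number `x`. -/
def LTp (p i : ℕ) (x : List (BoolCircuit V)) : BoolCircuit V :=
  LT x (natBits (2 ^ i * p).size (2 ^ i * p))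

/-- The number `x - 2 ^ i * p` in two's complement, for an unsigned number `x`. -/
def SUBPROD (p : ℕ) (x : List (BoolCircuit V)) (i : ℕ) : List (BoolCircuit V) :=
  ADD (x ++ [const false]) (PROD (intBits (-2 ^ i)) (intBits p))

/-- If `x < 2 ^ i * p` then `x`, else `x - 2 ^ i * p`. -/
def REMstep (p i : ℕ) (x : List (BoolCircuit V)) : List (BoolCircuit V) :=
  (List.range x.length).map fun j =>
    or (and (LTp p i x) (ubit x j)) (and (not (LTp p i x)) (sbit (SUBPROD p x i) j))

/-- The value after `i` iterations, for the exponents `b - 1, b - 2, …, b - i`, where `b` is the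
number of bits of `x`. -/
def REMiter (p : ℕ) (x : List (BoolCircuit V)) : ℕ → List (BoolCircuit V)
  | 0 => x
  | i + 1 => REMstep p (x.length - (i + 1)) (REMiter p x i)

/-- The remainder modulo `p` of an unsigned number, as an unsigned number of
`p.size = ⌊log₂ p⌋ + 1` bits. -/
def REM (p : ℕ) (x : List (BoolCircuit V)) : List (BoolCircuit V) :=
  (List.range p.size).map fun j => ubit (REMiter p x x.length) j

def ADDp (p : ℕ) (x y : List (BoolCircuit V)) : List (BoolCircuit V) :=
  REM p (ADDplus x y)

def PRODp (p : ℕ) (x y : List (BoolCircuit V)) : List (BoolCircuit V) :=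
  REM p (PRODplus x y)

/-- The binary value modulo `p` of a vector of Boolean circuits. -/
noncomputable def VALp (p : ℕ) (x : List (BoolCircuit V)) : MvPolynomial V (ZMod p) :=
  ∑ i ∈ Finset.range x.length, MvPolynomial.C (2 ^ i : ZMod p) * (ubit x i).alg (ZMod p)

/-- The bits of an element of `𝔽_p`, seen as an element of `{0, …, p - 1}`. -/
def constBits (p : ℕ) (α : ZMod p) : List (BoolCircuit V) :=
  natBits p.size α.val

/-- The bits of `α * u` from the bits `x` of `u`: a wire with the label `1` passes its bits on, any
other label is multiplied by `PROD_p`. -/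
def scaleBits (p : ℕ) (α : ZMod p) (x : List (BoolCircuit V)) : List (BoolCircuit V) :=
  if α = 1 then x else PRODp p (constBits p α) x

/-- The bits of a linear combination, by repeated use of `ADD_p`; in particular the bits of `u + w`
are `ADD_p` of the bits of `u` and those of `w`. -/
def linBits (p : ℕ) : List (ZMod p × List (BoolCircuit V)) → List (BoolCircuit V)
  | [] => constBits p 0
  | [e] => scaleBits p e.1 e.2
  | e :: e' :: l => ADDp p (scaleBits p e.1 e.2) (linBits p (e' :: l))

end BoolCircuit

/-! ## Bit extraction modulo `p` -/

/-- The bits `x_{i,0}, …, x_{i,b-1}` of the variable `x_i`, where `b = p.size = ⌊log₂ p⌋ + 1`. -/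
def varBits (p : ℕ) {n : ℕ} (i : Fin n) : List (BoolCircuit (Fin n × Fin p.size)) :=
  (List.finRange p.size).map fun j => BoolCircuit.var (i, j)

/-- The bits of a gate, from the bits `B` and the polynomials `f` of its predecessors. An inversion
gate is treated as the constant that it computes. -/
noncomputable def AlgCirc.Gate.BITp {p n k : ℕ}
    (B : Fin k → List (BoolCircuit (Fin n × Fin p.size)))
    (f : Fin k → MvPolynomial (Fin n) (ZMod p)) :
    AlgCirc.Gate (ZMod p) (Fin n) k → List (BoolCircuit (Fin n × Fin p.size))
  | .var i => varBits p i
  | .const α => BoolCircuit.constBits p α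
  | .mul u w => BoolCircuit.PRODp p (B u) (B w)
  | .lin l => BoolCircuit.linBits p (l.map fun e => (e.1, B e.2))
  | .inv u => BoolCircuit.constBits p (MvPolynomial.constantCoeff (Ring.inverse (f u)))

noncomputable def AlgCirc.Gates.BITp {p n : ℕ} :
    {k : ℕ} → AlgCirc.Gates (ZMod p) (Fin n) k → Fin k →
      List (BoolCircuit (Fin n × Fin p.size))
  | _, .nil => Fin.elim0
  | _, .snoc c g => Fin.snoc (α := fun _ => List (BoolCircuit (Fin n × Fin p.size)))
      c.BITp (g.BITp c.BITp c.poly)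

/-- The vector of Boolean circuits that compute the bits of the output of `F`. -/
noncomputable def AlgCircuit.BITp {p n : ℕ} (F : AlgCircuit (ZMod p) (Fin n)) :
    List (BoolCircuit (Fin n × Fin p.size)) :=
  F.gates.BITp F.out

/-!
Certificates of Boolean identities add up to certificates of identities between values.

A polynomial in a fixed number of variables that vanishes on the Boolean cube lies in the ideal
generated by the Boolean axioms, already over `ℤ`; hence it has a certificate of constant size,
which specializes to every commutative ring and to all substitutions of circuits that are certified
to be Boolean. Every gate of an adder, a multiplier or a comparison takes part in such a local
identity: for a full adder it is `sum + 2 * carry' = a + b + carry`. Summing these with weights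
`2 ^ i` makes the carries telescope and turns them into the additivity and multiplicativity of
`VAL_p`.

For the remainder, the carry into position `j` of `z - m` is related to the comparison of the `j`
lowest bits of `z` and `m`, by induction on `j`. Therefore the last carry is the negation of the
comparison bit, so that a division step changes the value by `0` or by `-m` with `m = 2 ^ i * p`,
which is `0` modulo `p`. Moreover, it turns `z < 2 * m` into `z < m`, so that after all steps
`z < p`, and the bits beyond the length of `p` can be dropped. Induction along the gates of `F`
does the rest.
-/

namespace BinaryValue

open MvPolynomial AlgCirc BoolCircuit

section Derivations

variable {R V : Type} [CommRing R]

/-- What the gates of a circuit can achieve: to compute `f`, or to compute an IPS certificate of `f`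
from the Boolean axioms. -/
inductive Line (R V : Type) [CommRing R] : Type
  | computed (f : MvPolynomial V R)
  | certified (f : MvPolynomial V R)

open Line

/-- The lines that one more gate adds to a circuit that has achieved `S`. -/
inductive Step (S : Set (Line R V)) : Line R V → Prop
  | var (v : V) : Step S (computed (X v))
  | const (a : R) : Step S (computed (C a))
  | axm (v : V) : Step S (certified (boolAxiom R V v))
  | zero : Step S (certified 0)
  | weaken {f} : certified f ∈ S → Step S (computed f)
  | lin (a b : R) {f g} : computed f ∈ S → computed g ∈ S → Step S (computed (C a * f + C b * g))
  | mul {f g} : computed f ∈ S → computed g ∈ S → Step S (computed (f * g))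
  | certifiedLin (a b : R) {f g} : certified f ∈ S → certified g ∈ S →
      Step S (certified (C a * f + C b * g))
  | certifiedMul {f g} : computed f ∈ S → certified g ∈ S → Step S (certified (f * g))

/-- From a circuit that has achieved `S`, at most `n` more gates achieve `T` as well. -/
inductive Derives : Set (Line R V) → ℕ → Set (Line R V) → Prop
  | of_subset {S T : Set (Line R V)} {n : ℕ} : T ⊆ S → Derives S n T
  | step {S T : Set (Line R V)} {n : ℕ} {φ : Line R V} :
      Step S φ → Derives (insert φ S) n T → Derives S (n + 1) T

variable {S S' T T' U : Set (Line R V)} {m n : ℕ}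

theorem Step.mono {φ : Line R V} (h : Step S φ) (hS : S ⊆ S') : Step S' φ := by
  cases h with
  | var v => exact .var v
  | const a => exact .const a
  | axm v => exact .axm v
  | zero => exact .zero
  | weaken hf => exact .weaken (hS hf)
  | lin a b hf hg => exact .lin a b (hS hf) (hS hg)
  | mul hf hg => exact .mul (hS hf) (hS hg)
  | certifiedLin a b hf hg => exact .certifiedLin a b (hS hf) (hS hg)
  | certifiedMul hf hg => exact .certifiedMul (hS hf) (hS hg)

theorem Step.derives {φ : Line R V} (h : Step S φ) : Derives S 1 {φ} :=
  .step h (.of_subset (Set.singleton_subset_iff.2 (Set.mem_insert φ S)))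

namespace Derives

theorem mono (h : Derives S n T) (hS : S ⊆ S') (hn : n ≤ m) (hT : T' ⊆ T) :
    Derives S' m T' := by
  induction h generalizing S' m with
  | of_subset h => exact .of_subset ((hT.trans h).trans hS)
  | step hφ _ ih =>
    obtain ⟨m, rfl⟩ := Nat.exists_eq_add_of_le' (Nat.one_le_of_lt (Nat.lt_of_succ_le hn))
    exact .step (hφ.mono hS) (ih (Set.insert_subset_insert hS) (Nat.le_of_succ_le_succ hn) hT)

theorem mono_left (h : Derives S n T) (hS : S ⊆ S') : Derives S' n T :=
  h.mono hS le_rfl subset_rfl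

theorem mono_right (h : Derives S n T) (hT : T' ⊆ T) : Derives S n T' :=
  h.mono subset_rfl le_rfl hT

theorem mono_cost (h : Derives S n T) (hn : n ≤ m) : Derives S m T :=
  h.mono subset_rfl hn subset_rfl

theorem union_left (h : Derives S n T) : Derives S n (S ∪ T) := by
  induction h with
  | of_subset h => exact .of_subset (Set.union_subset subset_rfl h)
  | step hφ _ ih =>
    exact .step hφ (ih.mono_right (Set.union_subset_union_left _ (Set.subset_insert _ _)))

theorem trans (h : Derives S n T) (h' : Derives (S ∪ T) m U) : Derives S (n + m) (T ∪ U) := by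
  induction h with
  | of_subset h =>
    rw [Set.union_eq_left.2 h] at h'
    exact h'.union_left.mono subset_rfl (Nat.le_add_left _ _) (Set.union_subset_union_left _ h)
  | step hφ _ ih =>
    rw [Nat.add_right_comm]
    exact .step hφ (ih (h'.mono_left (Set.union_subset_union_left _ (Set.subset_insert _ _))))

theorem union (h : Derives S n T) (h' : Derives S m U) : Derives S (n + m) (T ∪ U) :=
  h.trans (h'.mono_left Set.subset_union_left)

theorem biUnion_lt {T : ℕ → Set (Line R V)}
    (h : ∀ i < m, Derives (S ∪ ⋃ j < i, T j) n (T i)) : Derives S (m * n) (⋃ i < m, T i) := by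
  induction m with
  | zero => exact .of_subset (by simp)
  | succ m ih =>
    rw [Set.biUnion_lt_succ, add_one_mul]
    exact (ih fun i hi => h i (hi.trans (Nat.lt_succ_self m))).trans (h m (Nat.lt_succ_self m))

variable {f g : MvPolynomial V R}

theorem computed_const (a : R) : Derives S 1 {computed (C a)} :=
  (Step.const a).derives

theorem computed_lin (a b : R) (hf : Derives S m {computed f}) (hg : Derives S n {computed g}) :
    Derives S (m + n + 1) {computed (C a * f + C b * g)} :=
  ((hf.union hg).trans (Step.lin a b (by simp) (by simp)).derives).mono_right
    Set.subset_union_right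

theorem computed_add (hf : Derives S m {computed f}) (hg : Derives S n {computed g}) :
    Derives S (m + n + 1) {computed (f + g)} := by
  simpa using hf.computed_lin 1 1 hg

theorem computed_mul (hf : Derives S m {computed f}) (hg : Derives S n {computed g}) :
    Derives S (m + n + 1) {computed (f * g)} :=
  ((hf.union hg).trans (Step.mul (by simp) (by simp)).derives).mono_right Set.subset_union_right

theorem certified_lin (a b : R) (hf : Derives S m {certified f}) (hg : Derives S n {certified g}) :
    Derives S (m + n + 1) {certified (C a * f + C b * g)} :=
  ((hf.union hg).trans (Step.certifiedLin a b (by simp) (by simp)).derives).mono_right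
    Set.subset_union_right

theorem certified_add (hf : Derives S m {certified f}) (hg : Derives S n {certified g}) :
    Derives S (m + n + 1) {certified (f + g)} := by
  simpa using hf.certified_lin 1 1 hg

theorem certified_mul (hf : Derives S m {computed f}) (hg : Derives S n {certified g}) :
    Derives S (m + n + 1) {certified (f * g)} :=
  ((hf.union hg).trans (Step.certifiedMul (by simp) (by simp)).derives).mono_right
    Set.subset_union_right

theorem computed_sum {f : ℕ → MvPolynomial V R} (a : ℕ → R)
    (h : ∀ i < m, Derives S n {computed (f i)}) :
    Derives S (m * (n + 1) + 1) {computed (∑ i ∈ Finset.range m, C (a i) * f i)} := by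
  induction m with
  | zero => simpa using computed_const (S := S) (0 : R)
  | succ m ih =>
    have hm := (ih fun i hi => h i (hi.trans m.lt_succ_self)).computed_lin 1 (a m)
      (h m m.lt_succ_self)
    rw [Finset.sum_range_succ]
    simpa only [C_1, one_mul] using hm.mono_cost (by rw [add_one_mul]; omega)

theorem certified_sum {f : ℕ → MvPolynomial V R} (a : ℕ → R)
    (h : ∀ i < m, Derives S n {certified (f i)}) :
    Derives S (m * (n + 1) + 1) {certified (∑ i ∈ Finset.range m, C (a i) * f i)} := by
  induction m with
  | zero => simpa using (Step.zero (S := S)).derives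
  | succ m ih =>
    have hm := (ih fun i hi => h i (hi.trans m.lt_succ_self)).certified_lin 1 (a m)
      (h m m.lt_succ_self)
    rw [Finset.sum_range_succ]
    simpa only [C_1, one_mul] using hm.mono_cost (by rw [add_one_mul]; omega)

end Derives

end Derivations

section Soundness

variable {R V : Type} [CommRing R]

/-- The circuit `c`, in which `Sum.inr v` is the placeholder of the Boolean axiom for `v`, has a
gate with the property that the line describes. -/
def Achieves {k : ℕ} (c : Gates R (V ⊕ V) k) : Line R V → Prop
  | .computed f => ∃ u, aeval (Sum.elim X (boolAxiom R V)) (c.poly u) = f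
  | .certified f => ∃ u, aeval (Sum.elim X (boolAxiom R V)) (c.poly u) = f ∧
      aeval (Sum.elim (X (R := R) (σ := V)) fun _ => 0) (c.poly u) = 0

theorem Achieves.snoc {k : ℕ} {c : Gates R (V ⊕ V) k} {φ : Line R V} (h : Achieves c φ)
    (g : Gate R (V ⊕ V) k) : Achieves (c.snoc g) φ := by
  cases φ with
  | computed f =>
    obtain ⟨u, hu⟩ := h
    exact ⟨u.castSucc, by rwa [Gates.poly, Fin.snoc_castSucc]⟩
  | certified f =>
    obtain ⟨u, hu⟩ := h
    exact ⟨u.castSucc, by rwa [Gates.poly, Fin.snoc_castSucc]⟩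

theorem achieves_computed_snoc {k : ℕ} {c : Gates R (V ⊕ V) k} {g : Gate R (V ⊕ V) k}
    {f : MvPolynomial V R} (h : aeval (Sum.elim X (boolAxiom R V)) (g.poly c.poly) = f) :
    Achieves (c.snoc g) (.computed f) :=
  ⟨Fin.last k, by rwa [Gates.poly, Fin.snoc_last]⟩

theorem achieves_certified_snoc {k : ℕ} {c : Gates R (V ⊕ V) k} {g : Gate R (V ⊕ V) k}
    {f : MvPolynomial V R} (h : aeval (Sum.elim X (boolAxiom R V)) (g.poly c.poly) = f)
    (h0 : aeval (Sum.elim (X (R := R) (σ := V)) fun _ => 0) (g.poly c.poly) = 0) :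
    Achieves (c.snoc g) (.certified f) :=
  ⟨Fin.last k, by rw [Gates.poly, Fin.snoc_last]; exact ⟨h, h0⟩⟩

variable {p : ℕ} [NeZero p]

theorem bitSize_lin_pair_le {k : ℕ} (a b : ZMod p) (u w : Fin k) :
    (Gate.lin (V := V) [(a, u), (b, w)]).bitSize ≤ 2 * p.size + 3 := by
  have hval (c : ZMod p) : c.val.size ≤ p.size := Nat.size_le_size (ZMod.val_le c)
  simp only [Gate.bitSize, List.map_cons, List.map_nil, List.sum_cons, List.sum_nil]
  linarith [hval a, hval b]

theorem Step.exists_gate {S : Set (Line (ZMod p) V)} {φ : Line (ZMod p) V} (h : Step S φ) {k : ℕ}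
    (c : Gates (ZMod p) (V ⊕ V) k) (hc : ∀ ψ ∈ S, Achieves c ψ) :
    ∃ g : Gate (ZMod p) (V ⊕ V) k, g.Admissible c ∧ g.bitSize ≤ 2 * p.size + 3 ∧
      Achieves (c.snoc g) φ := by
  cases h with
  | var v =>
    exact ⟨.var (.inl v), trivial, by simp [Gate.bitSize],
      achieves_computed_snoc (by simp [Gate.poly])⟩
  | const a =>
    have ha : a.val.size ≤ p.size := Nat.size_le_size (ZMod.val_le a)
    exact ⟨.const a, trivial, by simp only [Gate.bitSize]; omega,
      achieves_computed_snoc (by simp [Gate.poly])⟩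
  | axm v =>
    exact ⟨.var (.inr v), trivial, by simp [Gate.bitSize],
      achieves_certified_snoc (by simp [Gate.poly]) (by simp [Gate.poly])⟩
  | zero =>
    exact ⟨.lin [], trivial, by simp [Gate.bitSize],
      achieves_certified_snoc (by simp [Gate.poly]) (by simp [Gate.poly])⟩
  | weaken hf =>
    obtain ⟨u, hu, -⟩ := hc _ hf
    exact ⟨.lin [], trivial, by simp [Gate.bitSize], Achieves.snoc (φ := .computed _) ⟨u, hu⟩ _⟩
  | lin a b hf hg =>
    obtain ⟨u, hu⟩ := hc _ hf
    obtain ⟨w, hw⟩ := hc _ hg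
    exact ⟨.lin [(a, u), (b, w)], trivial, bitSize_lin_pair_le a b u w,
      achieves_computed_snoc (by simp [-aeval_eq_bind₁, Gate.poly, hu, hw])⟩
  | mul hf hg =>
    obtain ⟨u, hu⟩ := hc _ hf
    obtain ⟨w, hw⟩ := hc _ hg
    exact ⟨.mul u w, trivial, by simp only [Gate.bitSize]; omega,
      achieves_computed_snoc (by simp [-aeval_eq_bind₁, Gate.poly, hu, hw])⟩
  | certifiedLin a b hf hg =>
    obtain ⟨u, hu, hu0⟩ := hc _ hf
    obtain ⟨w, hw, hw0⟩ := hc _ hg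
    exact ⟨.lin [(a, u), (b, w)], trivial, bitSize_lin_pair_le a b u w,
      achieves_certified_snoc (by simp [-aeval_eq_bind₁, Gate.poly, hu, hw])
        (by simp [-aeval_eq_bind₁, Gate.poly, hu0, hw0])⟩
  | certifiedMul hf hg =>
    obtain ⟨u, hu⟩ := hc _ hf
    obtain ⟨w, hw, hw0⟩ := hc _ hg
    exact ⟨.mul u w, trivial, by simp only [Gate.bitSize]; omega,
      achieves_certified_snoc (by simp [-aeval_eq_bind₁, Gate.poly, hu, hw])
        (by simp [-aeval_eq_bind₁, Gate.poly, hw0])⟩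

theorem Derives.exists_gates {S T : Set (Line (ZMod p) V)} {n : ℕ} (h : Derives S n T) {k : ℕ}
    (c : Gates (ZMod p) (V ⊕ V) k) (hadm : c.Admissible) (hc : ∀ φ ∈ S, Achieves c φ) :
    ∃ (l : ℕ) (d : Gates (ZMod p) (V ⊕ V) l), d.Admissible ∧
      d.bitSize ≤ c.bitSize + n * (2 * p.size + 3) ∧ ∀ φ ∈ T, Achieves d φ := by
  induction h generalizing k with
  | of_subset h => exact ⟨k, c, hadm, Nat.le_add_right _ _, fun φ hφ => hc φ (h hφ)⟩
  | step hφ _ ih =>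
    obtain ⟨g, hg, hsize, hach⟩ := hφ.exists_gate c hc
    obtain ⟨l, d, hd, hdsize, hdach⟩ := ih (c.snoc g) ⟨hadm, hg⟩
      (Set.forall_mem_insert.2 ⟨hach, fun ψ hψ => (hc ψ hψ).snoc g⟩)
    refine ⟨l, d, hd, hdsize.trans ?_, hdach⟩
    rw [Gates.bitSize, add_one_mul]
    omega

theorem Derives.exists_isIPSProof {f : MvPolynomial V (ZMod p)} {n : ℕ}
    (h : Derives ∅ n {.certified f}) :
    ∃ P : AlgCircuit (ZMod p) (V ⊕ V), IsIPSProof P (boolAxiom (ZMod p) V) f ∧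
      P.bitSize ≤ n * (2 * p.size + 3) := by
  obtain ⟨l, d, hadm, hsize, hach⟩ := h.exists_gates .nil trivial (by simp)
  obtain ⟨u, hu⟩ := hach _ rfl
  exact ⟨⟨l, d, hadm, u⟩, hu, by simpa [AlgCircuit.bitSize, Gates.bitSize] using hsize⟩

end Soundness

section BooleanReasoning

open Line

section Polynomials

variable {σ : Type}

theorem exists_derives_computed_aeval (q : MvPolynomial σ ℤ) :
    ∃ N, ∀ (R V : Type) [CommRing R] (g : σ → MvPolynomial V R),
      Derives (Set.range fun i => computed (g i)) N {computed (aeval g q)} := by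
  induction q using MvPolynomial.induction_on with
  | C a => exact ⟨1, fun R V _ g => by simpa using Derives.computed_const (a : R)⟩
  | add q r hq hr =>
    obtain ⟨M, hM⟩ := hq
    obtain ⟨N, hN⟩ := hr
    exact ⟨M + N + 1, fun R V _ g => by rw [map_add]; exact (hM R V g).computed_add (hN R V g)⟩
  | mul_X q i hq =>
    obtain ⟨N, hN⟩ := hq
    refine ⟨N + 0 + 1, fun R V _ g => ?_⟩
    rw [map_mul, aeval_X]
    exact (hN R V g).computed_mul (.of_subset (n := 0) (Set.singleton_subset_iff.2 ⟨i, rfl⟩))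

theorem exists_derives_certified_of_mem_span {H : Set (MvPolynomial σ ℤ)} {q : MvPolynomial σ ℤ}
    (hq : q ∈ Ideal.span H) :
    ∃ N, ∀ (R V : Type) [CommRing R] (g : σ → MvPolynomial V R),
      Derives ((Set.range fun i => computed (g i)) ∪ (fun f => certified (aeval g f)) '' H) N
        {certified (aeval g q)} := by
  induction hq using Submodule.span_induction with
  | mem q hq =>
    exact ⟨0, fun R V _ g => .of_subset (Set.singleton_subset_iff.2 (.inr ⟨q, hq, rfl⟩))⟩
  | zero => exact ⟨1, fun R V _ g => by rw [map_zero]; exact Step.zero.derives⟩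
  | add q r _ _ hq hr =>
    obtain ⟨M, hM⟩ := hq
    obtain ⟨N, hN⟩ := hr
    exact ⟨M + N + 1, fun R V _ g => by rw [map_add]; exact (hM R V g).certified_add (hN R V g)⟩
  | smul r q _ hq =>
    obtain ⟨N, hN⟩ := hq
    obtain ⟨M, hM⟩ := exists_derives_computed_aeval r
    refine ⟨M + N + 1, fun R V _ g => ?_⟩
    rw [smul_eq_mul, map_mul]
    exact ((hM R V g).mono_left Set.subset_union_left).certified_mul (hN R V g)

end Polynomials

section Cube

variable {σ : Type}

/-- The value of a Boolean circuit at the Boolean point `a`. -/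
def truth (a : σ → Bool) : BoolCircuit σ → Bool
  | .var v => a v
  | .const b => b
  | .not c => !truth a c
  | .and c d => truth a c && truth a d
  | .or c d => truth a c || truth a d

/-- The Boolean point `a` as a point of affine space. -/
def boolPoint (R : Type) [CommRing R] (a : σ → Bool) (i : σ) : R := if a i then 1 else 0

theorem eval_boolPoint_alg (R : Type) [CommRing R] (a : σ → Bool) (c : BoolCircuit σ) :
    eval (boolPoint R a) (c.alg R) = if truth a c then 1 else 0 := by
  induction c with
  | var v => rw [alg, eval_X, truth, boolPoint]
  | const b => cases b <;> simp [alg, truth]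
  | not c ih => cases h : truth a c <;> simp_all [alg, truth]
  | and c d hc hd => cases h : truth a c <;> simp_all [alg, truth]
  | or c d hc hd => cases h : truth a c <;> simp_all [alg, truth]

theorem mem_span_boolAxiom_of_eval_eq_zero {R : Type} [CommRing R] [IsDomain R] [Finite σ]
    {q : MvPolynomial σ R} (hq : ∀ a : σ → Bool, eval (boolPoint R a) q = 0) :
    q ∈ Ideal.span (Set.range (boolAxiom R σ)) := by
  classical
  obtain ⟨h, -, hh⟩ := combinatorial_nullstellensatz_exists_linearCombination
    (fun _ : σ => ({0, 1} : Finset R)) (fun _ => by simp) q fun x hx => by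
      have hx' : x = boolPoint R fun i => x i = 1 := by
        ext i
        have := hx i
        rw [Finset.mem_insert, Finset.mem_singleton] at this
        rcases this with h | h <;> simp [boolPoint, h]
      rw [hx']
      exact hq _
  rw [hh, Finsupp.linearCombination_apply]
  refine Ideal.sum_mem _ fun i _ => ?_
  have hi : ∏ r ∈ ({0, 1} : Finset R), (X i - C r) = boolAxiom R σ i := by
    rw [Finset.prod_pair zero_ne_one, boolAxiom, C_0, C_1]
    ring
  simp only [hi, smul_eq_mul]
  exact Ideal.mul_mem_left _ _ (Ideal.subset_span (Set.mem_range_self i))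

/-- Multiplying `q` by the hypotheses makes it vanish on the whole cube, and modulo the ideal this
changes nothing. -/
theorem mem_span_of_eval_eq_zero {R : Type} [CommRing R] [IsDomain R] [Finite σ]
    {H : List (BoolCircuit σ)} {q : MvPolynomial σ R}
    (hq : ∀ a : σ → Bool, (∀ c ∈ H, truth a c = true) → eval (boolPoint R a) q = 0) :
    q ∈ Ideal.span (Set.range (boolAxiom R σ) ∪ (fun c => 1 - c.alg R) '' {c | c ∈ H}) := by
  set I := Ideal.span (Set.range (boolAxiom R σ) ∪ (fun c => 1 - c.alg R) '' {c | c ∈ H})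
  have hprod : 1 - (H.map (alg R)).prod ∈ I := by
    rw [← Ideal.Quotient.eq, map_one, map_list_prod, eq_comm]
    refine List.prod_eq_one fun x hx => ?_
    simp only [List.map_map, List.mem_map, Function.comp_apply] at hx
    obtain ⟨c, hc, rfl⟩ := hx
    rw [← map_one (Ideal.Quotient.mk I), eq_comm, Ideal.Quotient.eq]
    exact Ideal.subset_span (.inr ⟨c, hc, rfl⟩)
  have hvanish : q * (H.map (alg R)).prod ∈ I := by
    refine Ideal.span_mono Set.subset_union_left (mem_span_boolAxiom_of_eval_eq_zero fun a => ?_)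
    by_cases hH : ∀ c ∈ H, truth a c = true
    · rw [map_mul, hq a hH, zero_mul]
    · push Not at hH
      obtain ⟨c, hc, hca⟩ := hH
      rw [map_mul, map_list_prod, List.prod_eq_zero, mul_zero]
      exact List.mem_map.2 ⟨alg R c, List.mem_map_of_mem hc, by simp [eval_boolPoint_alg, hca]⟩
  convert I.add_mem (I.mul_mem_left q hprod) hvanish using 1
  ring

end Cube

section Templates

/-- The circuit `c` with the circuit `w i` in place of the variable `i`. -/
def subst {σ V : Type} (w : σ → BoolCircuit V) : BoolCircuit σ → BoolCircuit V
  | .var i => w i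
  | .const b => .const b
  | .not c => .not (subst w c)
  | .and c d => .and (subst w c) (subst w d)
  | .or c d => .or (subst w c) (subst w d)

variable {σ : Type}

theorem alg_subst {V : Type} (R : Type) [CommRing R] (w : σ → BoolCircuit V) (c : BoolCircuit σ) :
    (subst w c).alg R = aeval (fun i => (w i).alg R) (c.alg ℤ) := by
  induction c with
  | var i => simp [subst, alg]
  | const b => cases b <;> simp [subst, alg]
  | not c ih => simp [subst, alg, ih]
  | and c d hc hd => simp [subst, alg, hc, hd]
  | or c d hc hd => simp [subst, alg, hc, hd]

variable {V : Type} (R : Type) [CommRing R]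

/-- The circuit `c` is computed and certified to take Boolean values. -/
def isBool (c : BoolCircuit V) : Set (Line R V) :=
  {computed (c.alg R), certified (c.alg R ^ 2 - c.alg R)}

/-- The circuit `c` is certified to take the value `1`. -/
def holds (c : BoolCircuit V) : Set (Line R V) :=
  {certified (1 - c.alg R)}

variable [Finite σ]

theorem exists_derives_certified (H : List (BoolCircuit σ)) (q : MvPolynomial σ ℤ)
    (hq : ∀ a : σ → Bool, (∀ c ∈ H, truth a c = true) → eval (boolPoint ℤ a) q = 0) :
    ∃ N, ∀ (R V : Type) [CommRing R] (w : σ → BoolCircuit V),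
      Derives ((⋃ i, isBool R (w i)) ∪ ⋃ c ∈ H, holds R (subst w c)) N
        {certified (aeval (fun i => (w i).alg R) q)} := by
  obtain ⟨N, hN⟩ := exists_derives_certified_of_mem_span (mem_span_of_eval_eq_zero hq)
  refine ⟨N, fun R V _ w => (hN R V _).mono_left ?_⟩
  rintro _ (⟨i, rfl⟩ | ⟨_, ⟨i, rfl⟩ | ⟨c, hc, rfl⟩, rfl⟩)
  · exact .inl (Set.mem_iUnion.2 ⟨i, .inl rfl⟩)
  · exact .inl (Set.mem_iUnion.2 ⟨i, .inr (by simp [boolAxiom])⟩)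
  · exact .inr (Set.mem_biUnion hc (by simp [holds, alg_subst]))

theorem exists_derives_isBool (c : BoolCircuit σ) :
    ∃ N, ∀ (R V : Type) [CommRing R] (w : σ → BoolCircuit V),
      Derives (⋃ i, isBool R (w i)) N (isBool R (subst w c)) := by
  obtain ⟨M, hM⟩ := exists_derives_computed_aeval (c.alg ℤ)
  obtain ⟨N, hN⟩ := exists_derives_certified [] (c.alg ℤ ^ 2 - c.alg ℤ) fun a _ => by
    cases h : truth a c <;> simp [eval_boolPoint_alg, h]
  refine ⟨M + N, fun R V _ w => ?_⟩
  rw [isBool, alg_subst, ← map_pow, ← map_sub]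
  refine ((hM R V _).mono_left ?_).union ((hN R V w).mono_left (by simp))
  rintro _ ⟨i, rfl⟩
  exact Set.mem_iUnion.2 ⟨i, .inl rfl⟩

theorem exists_derives_holds (H : List (BoolCircuit σ)) (c : BoolCircuit σ)
    (hc : ∀ a : σ → Bool, (∀ d ∈ H, truth a d = true) → truth a c = true) :
    ∃ N, ∀ (R V : Type) [CommRing R] (w : σ → BoolCircuit V),
      Derives ((⋃ i, isBool R (w i)) ∪ ⋃ d ∈ H, holds R (subst w d)) N
        (holds R (subst w c)) := by
  obtain ⟨N, hN⟩ := exists_derives_certified H (1 - c.alg ℤ) fun a ha => by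
    simp [eval_boolPoint_alg, hc a ha]
  refine ⟨N, fun R V _ w => ?_⟩
  simpa [holds, alg_subst] using hN R V w

end Templates

end BooleanReasoning

section Lists

variable {V : Type}

theorem map_eq_map_range (x : List (BoolCircuit V)) (f : BoolCircuit V → BoolCircuit V) :
    x.map f = (List.range x.length).map fun i => f (ubit x i) := by
  refine List.ext_getElem (by simp) fun i h _ => ?_
  simp only [List.length_map] at h
  simp [ubit, h]

theorem ubit_map_range (f : ℕ → BoolCircuit V) {m i : ℕ} (h : i < m) :
    ubit ((List.range m).map f) i = f i := by
  simp [ubit, h]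

theorem ubit_of_le {x : List (BoolCircuit V)} {i : ℕ} (h : x.length ≤ i) :
    ubit x i = const false := by
  simp [ubit, h]

theorem sign_append_false (x : List (BoolCircuit V)) : sign (x ++ [const false]) = const false := by
  simp [sign]

theorem sbit_append_false (x : List (BoolCircuit V)) (i : ℕ) :
    sbit (x ++ [const false]) i = ubit x i := by
  rw [sbit, sign_append_false, ubit]
  rcases lt_or_ge i x.length with h | h
  · rw [List.getD_append _ _ _ _ h]
  · rw [List.getD_append_right _ _ _ _ h, List.getD_eq_default _ _ h]
    rcases h.eq_or_lt with h | h
    · simp [h]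
    · rw [List.getD_eq_default]
      simp; omega

/-- The bit `i` of the sum of two numbers in two's complement. -/
def sumBit (x y : List (BoolCircuit V)) (i : ℕ) : BoolCircuit V :=
  xor (xor (sbit x i) (sbit y i)) (CARRY x y i)

theorem ADD_eq (x y : List (BoolCircuit V)) :
    ADD x y = (List.range (max x.length y.length + 1)).map (sumBit x y) := rfl

theorem ADDplus_eq (x y : List (BoolCircuit V)) :
    ADDplus x y = (List.range (max x.length y.length + 1)).map
      (sumBit (x ++ [const false]) (y ++ [const false])) := by
  rw [ADDplus, ADD_eq, List.range_succ, List.map_append, List.map_singleton, List.dropLast_concat]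
  simp

theorem length_ADDplus (x y : List (BoolCircuit V)) :
    (ADDplus x y).length = max x.length y.length + 1 := by
  simp [ADDplus_eq]

theorem length_PRODplusAux (x y : List (BoolCircuit V)) (i : ℕ) :
    (PRODplusAux x y i).length = x.length + i := by
  induction i with
  | zero => simp [PRODplusAux]
  | succ i ih =>
    simp [PRODplusAux, length_ADDplus, ih]
    omega

theorem length_PRODplus (x y : List (BoolCircuit V)) :
    (PRODplus x y).length = x.length + y.length :=
  length_PRODplusAux x y _

end Lists

section Values

variable {V : Type} (p : ℕ)

theorem VALp_eq_sum (x : List (BoolCircuit V)) {m : ℕ} (h : x.length ≤ m) :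
    VALp p x = ∑ i ∈ Finset.range m, C (2 ^ i : ZMod p) * (ubit x i).alg (ZMod p) := by
  refine Finset.sum_subset (by simpa using h) fun i _ hi => ?_
  rw [ubit_of_le (by simpa using hi)]
  simp [alg]

theorem VALp_map_range (f : ℕ → BoolCircuit V) (m : ℕ) :
    VALp p ((List.range m).map f) =
      ∑ i ∈ Finset.range m, C (2 ^ i : ZMod p) * (f i).alg (ZMod p) := by
  rw [VALp]
  simp only [List.length_map, List.length_range]
  exact Finset.sum_congr rfl fun i hi => by rw [ubit_map_range f (Finset.mem_range.1 hi)]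

theorem VALp_nil : VALp p ([] : List (BoolCircuit V)) = 0 := by simp [VALp]

theorem VALp_cons (a : BoolCircuit V) (x : List (BoolCircuit V)) :
    VALp p (a :: x) = a.alg (ZMod p) + C 2 * VALp p x := by
  rw [VALp, VALp, List.length_cons, Finset.sum_range_succ', Finset.mul_sum, add_comm]
  congr 1
  · simp [ubit]
  · refine Finset.sum_congr rfl fun i _ => ?_
    simp only [ubit, List.getD_cons_succ, pow_succ, C_mul]
    ring

theorem VALp_append (x y : List (BoolCircuit V)) :
    VALp p (x ++ y) = VALp p x + C (2 ^ x.length) * VALp p y := by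
  induction x with
  | nil => simp [VALp_nil]
  | cons a x ih =>
    simp only [List.cons_append, VALp_cons, ih, List.length_cons, pow_succ, C_mul]
    ring

theorem VALp_map_and (x : List (BoolCircuit V)) (c : BoolCircuit V) :
    VALp p (x.map fun a => and a c) = VALp p x * c.alg (ZMod p) := by
  induction x with
  | nil => simp [VALp_nil]
  | cons a x ih =>
    simp only [List.map_cons, VALp_cons, ih, alg]
    ring

theorem VALp_replicate_false (m : ℕ) :
    VALp p (List.replicate m (const false) : List (BoolCircuit V)) = 0 := by
  induction m with
  | zero => exact VALp_nil p
  | succ m ih => simp [List.replicate_succ, VALp_cons, ih, alg]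

end Values

section BitVectors

open Line

variable {V : Type} {R : Type} [CommRing R]

variable (R) in
/-- The bits of `x`, as well as the constant `false` that pads them, are computed and certified to
take Boolean values. -/
def areBool (x : List (BoolCircuit V)) : Set (Line R V) :=
  ⋃ c ∈ const false :: x, isBool R c

theorem subset_biUnion_lt {α : Type} (T : ℕ → Set α) {i m : ℕ} (h : i < m) : T i ⊆ ⋃ j < m, T j :=
  Set.subset_iUnion₂ (s := fun j (_ : j < m) => T j) i h

variable (R) in
/-- The first `n` circuits `f j` are computed and certified to take Boolean values. -/
def allBool (f : ℕ → BoolCircuit V) (n : ℕ) : Set (Line R V) :=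
  ⋃ j < n, isBool R (f j)

variable (R) in
/-- The first `n` circuits `f j` are certified to take the value `1`. -/
def allHold (f : ℕ → BoolCircuit V) (n : ℕ) : Set (Line R V) :=
  ⋃ j < n, holds R (f j)

theorem isBool_subset_allBool (f : ℕ → BoolCircuit V) {j n : ℕ} (h : j < n) :
    isBool R (f j) ⊆ allBool R f n :=
  subset_biUnion_lt (fun j => isBool R (f j)) h

theorem holds_subset_allHold (f : ℕ → BoolCircuit V) {j n : ℕ} (h : j < n) :
    holds R (f j) ⊆ allHold R f n :=
  subset_biUnion_lt (fun j => holds R (f j)) h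

theorem allBool_mono (f : ℕ → BoolCircuit V) {m n : ℕ} (h : m ≤ n) :
    allBool R f m ⊆ allBool R f n :=
  Set.biUnion_subset_biUnion_left fun _ hj => lt_of_lt_of_le hj h

theorem allHold_mono (f : ℕ → BoolCircuit V) {m n : ℕ} (h : m ≤ n) :
    allHold R f m ⊆ allHold R f n :=
  Set.biUnion_subset_biUnion_left fun _ hj => lt_of_lt_of_le hj h

theorem isBool_subset_areBool {x : List (BoolCircuit V)} {c : BoolCircuit V}
    (hc : c ∈ const false :: x) : isBool R c ⊆ areBool R x :=
  Set.subset_biUnion_of_mem (u := fun c => isBool R c) hc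

theorem areBool_subset {x : List (BoolCircuit V)} {S : Set (Line R V)}
    (h0 : isBool R (const false) ⊆ S) (h : ∀ c ∈ x, isBool R c ⊆ S) : areBool R x ⊆ S :=
  Set.iUnion₂_subset (List.forall_mem_cons.2 ⟨h0, h⟩)

theorem areBool_mono {x y : List (BoolCircuit V)} (h : x ⊆ const false :: y) :
    areBool R x ⊆ areBool R y :=
  areBool_subset (isBool_subset_areBool List.mem_cons_self) fun _ hc =>
    isBool_subset_areBool (h hc)

theorem areBool_subset_cons (c : BoolCircuit V) (x : List (BoolCircuit V)) :
    areBool R x ⊆ areBool R (c :: x) :=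
  areBool_mono (List.subset_cons_of_subset _ (List.subset_cons_self _ _))

theorem areBool_cons_subset (c : BoolCircuit V) (x : List (BoolCircuit V)) :
    areBool R (c :: x) ⊆ isBool R c ∪ areBool R x :=
  areBool_subset ((isBool_subset_areBool List.mem_cons_self).trans Set.subset_union_right)
    (List.forall_mem_cons.2 ⟨Set.subset_union_left, fun _ hd =>
      (isBool_subset_areBool (List.mem_cons_of_mem _ hd)).trans Set.subset_union_right⟩)

theorem areBool_append_subset (x y : List (BoolCircuit V)) :
    areBool R (x ++ y) ⊆ areBool R x ∪ areBool R y :=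
  areBool_subset
    ((isBool_subset_areBool List.mem_cons_self).trans Set.subset_union_left)
    fun _ hc => (List.mem_append.1 hc).elim
      (fun h => (isBool_subset_areBool (List.mem_cons_of_mem _ h)).trans Set.subset_union_left)
      fun h => (isBool_subset_areBool (List.mem_cons_of_mem _ h)).trans Set.subset_union_right

theorem ubit_mem (x : List (BoolCircuit V)) (i : ℕ) : ubit x i ∈ const false :: x := by
  rcases lt_or_ge i x.length with h | h
  · rw [ubit, List.getD_eq_getElem _ _ h]
    exact List.mem_cons_of_mem _ (List.getElem_mem h)
  · rw [ubit_of_le h]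
    exact List.mem_cons_self

theorem sbit_mem (x : List (BoolCircuit V)) (i : ℕ) : sbit x i ∈ const false :: x := by
  have hsign : sign x ∈ const false :: x := by
    cases x using List.reverseRecOn <;> simp [sign]
  rcases lt_or_ge i x.length with h | h
  · rw [sbit, List.getD_eq_getElem _ _ h]
    exact List.mem_cons_of_mem _ (List.getElem_mem h)
  · rwa [sbit, List.getD_eq_default _ _ h]

theorem isBool_ubit_subset (x : List (BoolCircuit V)) (i : ℕ) :
    isBool R (ubit x i) ⊆ areBool R x :=
  isBool_subset_areBool (ubit_mem x i)

theorem isBool_sbit_subset (x : List (BoolCircuit V)) (i : ℕ) :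
    isBool R (sbit x i) ⊆ areBool R x :=
  isBool_subset_areBool (sbit_mem x i)

theorem isBool_const_subset_areBool (b : Bool) (x : List (BoolCircuit V)) :
    isBool R (const b) ⊆ areBool R (const true :: x) :=
  isBool_subset_areBool (by cases b <;> simp)

theorem areBool_map_range_subset (f : ℕ → BoolCircuit V) (m : ℕ) :
    areBool R ((List.range m).map f) ⊆ isBool R (const false) ∪ allBool R f m := by
  refine areBool_subset Set.subset_union_left fun c hc => ?_
  obtain ⟨i, hi, rfl⟩ := List.mem_map.1 hc
  exact (isBool_subset_allBool f (List.mem_range.1 hi)).trans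
    Set.subset_union_right

theorem derives_isBool_const (S : Set (Line R V)) (b : Bool) :
    Derives S 2 (isBool R (const b)) := by
  have hb : (const b : BoolCircuit V).alg R = C (if b then 1 else 0) := by
    cases b <;> simp [alg]
  have hzero : (const b : BoolCircuit V).alg R ^ 2 - (const b).alg R = 0 := by
    cases b <;> simp [alg]
  rw [isBool, hzero, hb]
  exact (Derives.computed_const _).union Step.zero.derives

end BitVectors

section Addition

open Line

/-- The carry of a full adder. -/
def fullCarry {V : Type} (a b c : BoolCircuit V) : BoolCircuit V :=
  or (and a b) (and (or a b) c)

theorem exists_derives_CARRY :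
    ∃ N, ∀ (R V : Type) [CommRing R] (x y : List (BoolCircuit V)) (m : ℕ),
      Derives (areBool R x ∪ areBool R y) (m * N) (allBool R (CARRY x y) m) := by
  obtain ⟨N, hN⟩ := exists_derives_isBool
    (fullCarry (var 0) (var 1) (var 2) : BoolCircuit (Fin 3))
  refine ⟨N, fun R V _ x y m => .biUnion_lt fun i hi => ?_⟩
  cases i with
  | zero =>
    exact .of_subset (((isBool_subset_areBool List.mem_cons_self).trans
      Set.subset_union_left).trans Set.subset_union_left)
  | succ i =>
    refine (hN R V ![sbit x i, sbit y i, CARRY x y i]).mono_left (Set.iUnion_subset fun j => ?_)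
    fin_cases j
    · exact ((isBool_sbit_subset x i).trans Set.subset_union_left).trans Set.subset_union_left
    · exact ((isBool_sbit_subset y i).trans Set.subset_union_right).trans Set.subset_union_left
    · exact (isBool_subset_allBool (CARRY x y) i.lt_succ_self).trans
        Set.subset_union_right

theorem exists_derives_sumBit :
    ∃ N, ∀ (R V : Type) [CommRing R] (x y : List (BoolCircuit V)) (m : ℕ),
      Derives (areBool R x ∪ areBool R y ∪ allBool R (CARRY x y) m) (m * N)
        (allBool R (sumBit x y) m) := by
  obtain ⟨N, hN⟩ := exists_derives_isBool
    (.xor (.xor (var 0) (var 1)) (var 2) : BoolCircuit (Fin 3))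
  refine ⟨N, fun R V _ x y m => .biUnion_lt fun i hi => ?_⟩
  refine (hN R V ![sbit x i, sbit y i, CARRY x y i]).mono_left (Set.iUnion_subset fun j => ?_)
  refine Set.subset_union_of_subset_left ?_ _
  fin_cases j
  · exact ((isBool_sbit_subset x i).trans Set.subset_union_left).trans Set.subset_union_left
  · exact ((isBool_sbit_subset y i).trans Set.subset_union_right).trans Set.subset_union_left
  · exact (isBool_subset_allBool (CARRY x y) hi).trans Set.subset_union_right

theorem exists_derives_fullAdder :
    ∃ N, ∀ (R V : Type) [CommRing R] (a b c : BoolCircuit V),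
      Derives (isBool R a ∪ isBool R b ∪ isBool R c) N
        {certified ((BoolCircuit.xor (.xor a b) c).alg R + 2 * (fullCarry a b c).alg R -
          (a.alg R + b.alg R + c.alg R))} := by
  let s : BoolCircuit (Fin 3) := .xor (.xor (var 0) (var 1)) (var 2)
  let d : BoolCircuit (Fin 3) := fullCarry (var 0) (var 1) (var 2)
  obtain ⟨N, hN⟩ := exists_derives_certified [] (s.alg ℤ + 2 * d.alg ℤ -
      ((var 0 : BoolCircuit (Fin 3)).alg ℤ + (var 1 : BoolCircuit (Fin 3)).alg ℤ +
        (var 2 : BoolCircuit (Fin 3)).alg ℤ)) fun a _ => by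
    simp only [map_add, map_sub, map_mul, map_ofNat, eval_boolPoint_alg]
    revert a
    decide
  refine ⟨N, fun R V _ a b c => ?_⟩
  have h := hN R V ![a, b, c]
  simp only [map_add, map_sub, map_mul, map_ofNat, ← alg_subst] at h
  refine h.mono_left (Set.union_subset (Set.iUnion_subset fun i => ?_) (by simp))
  fin_cases i
  · exact Set.subset_union_left.trans Set.subset_union_left
  · exact Set.subset_union_right.trans Set.subset_union_left
  · exact Set.subset_union_right

theorem sum_two_pow_mul_fullAdder {A : Type} [CommRing A] (s a b c : ℕ → A) (n : ℕ) :
    ∑ i ∈ Finset.range n, 2 ^ i * (s i + 2 * c (i + 1) - (a i + b i + c i)) =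
      ∑ i ∈ Finset.range n, 2 ^ i * s i + 2 ^ n * c n - ∑ i ∈ Finset.range n, 2 ^ i * a i -
        ∑ i ∈ Finset.range n, 2 ^ i * b i - c 0 := by
  induction n with
  | zero => simp
  | succ n ih =>
    simp only [Finset.sum_range_succ, ih]
    ring

theorem exists_derives_sum_sumBit :
    ∃ N, ∀ (R V : Type) [CommRing R] (x y : List (BoolCircuit V)) (n : ℕ),
      Derives (areBool R x ∪ areBool R y ∪ allBool R (CARRY x y) n) (n * N + 1)
        {certified (∑ i ∈ Finset.range n, 2 ^ i * (sumBit x y i).alg R +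
          2 ^ n * (CARRY x y n).alg R - ∑ i ∈ Finset.range n, 2 ^ i * (sbit x i).alg R -
          ∑ i ∈ Finset.range n, 2 ^ i * (sbit y i).alg R)} := by
  obtain ⟨N, hN⟩ := exists_derives_fullAdder
  refine ⟨N + 1, fun R V _ x y n => ?_⟩
  have hsum : ∀ i < n, Derives (areBool R x ∪ areBool R y ∪ allBool R (CARRY x y) n) N
      {certified ((sumBit x y i).alg R + 2 * (CARRY x y (i + 1)).alg R -
        ((sbit x i).alg R + (sbit y i).alg R + (CARRY x y i).alg R))} := fun i hi =>
    (hN R V (sbit x i) (sbit y i) (CARRY x y i)).mono_left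
      (Set.union_subset_union (Set.union_subset_union (isBool_sbit_subset x i)
        (isBool_sbit_subset y i)) (isBool_subset_allBool (CARRY x y) hi))
  have h := Derives.certified_sum (fun i => (2 ^ i : R)) hsum
  simp only [C_pow, map_ofNat] at h
  have hfirst : (CARRY x y 0).alg R = 0 := by simp [CARRY, alg]
  rwa [sum_two_pow_mul_fullAdder (fun i => (sumBit x y i).alg R) (fun i => (sbit x i).alg R)
    (fun i => (sbit y i).alg R) (fun i => (CARRY x y i).alg R), hfirst, sub_zero] at h

theorem VALp_ADDplus_sub (p : ℕ) {V : Type} (x y : List (BoolCircuit V)) :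
    VALp p (ADDplus x y) - VALp p x - VALp p y =
      ∑ i ∈ Finset.range (max x.length y.length + 1),
          2 ^ i * (sumBit (x ++ [const false]) (y ++ [const false]) i).alg (ZMod p) +
        2 ^ (max x.length y.length + 1) *
          (CARRY (x ++ [const false]) (y ++ [const false]) (max x.length y.length + 1)).alg
            (ZMod p) -
        ∑ i ∈ Finset.range (max x.length y.length + 1),
          2 ^ i * (sbit (x ++ [const false]) i).alg (ZMod p) -
        ∑ i ∈ Finset.range (max x.length y.length + 1),
          2 ^ i * (sbit (y ++ [const false]) i).alg (ZMod p) := by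
  have hlast : (CARRY (x ++ [const false]) (y ++ [const false])
      (max x.length y.length + 1)).alg (ZMod p) = 0 := by
    simp [CARRY, sbit_append_false, ubit_of_le (le_max_left x.length y.length),
      ubit_of_le (le_max_right x.length y.length), alg]
  rw [ADDplus_eq, VALp_map_range, hlast,
    VALp_eq_sum p x (m := max x.length y.length + 1) (by omega),
    VALp_eq_sum p y (m := max x.length y.length + 1) (by omega)]
  simp only [C_pow, map_ofNat, sbit_append_false, mul_zero, add_zero]

theorem exists_derives_ADDplus :
    ∃ N, ∀ (p : ℕ) (V : Type) (x y : List (BoolCircuit V)),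
      Derives (areBool (ZMod p) x ∪ areBool (ZMod p) y) ((max x.length y.length + 1) * N)
        (areBool (ZMod p) (ADDplus x y) ∪
          {certified (VALp p (ADDplus x y) - VALp p x - VALp p y)}) := by
  obtain ⟨N₁, hN₁⟩ := exists_derives_CARRY
  obtain ⟨N₂, hN₂⟩ := exists_derives_sumBit
  obtain ⟨N₃, hN₃⟩ := exists_derives_sum_sumBit
  refine ⟨N₁ + (N₂ + (N₃ + 1)), fun p V x y => ?_⟩
  set m := max x.length y.length + 1
  set x' := x ++ [const false]
  set y' := y ++ [const false]
  have hpad (z : List (BoolCircuit V)) :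
      areBool (ZMod p) (z ++ [const false]) ⊆ areBool (ZMod p) z := areBool_mono (by simp)
  have hsum : Derives (areBool (ZMod p) x' ∪ areBool (ZMod p) y' ∪
      allBool (ZMod p) (CARRY x' y') m) (m * N₃ + 1)
      {certified (VALp p (ADDplus x y) - VALp p x - VALp p y)} := by
    rw [VALp_ADDplus_sub]
    exact hN₃ (ZMod p) V x' y' m
  have h := (hN₁ (ZMod p) V x' y' m).trans ((hN₂ (ZMod p) V x' y' m).union hsum)
  have hbits : areBool (ZMod p) (ADDplus x y) ⊆
      isBool (ZMod p) (const false) ∪ allBool (ZMod p) (sumBit x' y') m := by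
    rw [ADDplus_eq]
    exact areBool_map_range_subset _ m
  have hfalse : isBool (ZMod p) (const false) ⊆ areBool (ZMod p) x' :=
    isBool_subset_areBool List.mem_cons_self
  refine h.union_left.mono (Set.union_subset_union (hpad x) (hpad y)) ?_ ?_
  · have : 1 ≤ m := Nat.le_add_left _ _
    linarith
  · rintro φ (hφ | hφ)
    · exact (hbits hφ).elim (fun hφ => .inl (.inl (hfalse hφ))) fun hφ => .inr (.inr (.inl hφ))
    · exact .inr (.inr (.inr hφ))

end Addition

section Multiplication

open Line

variable {V : Type}

theorem exists_derives_map_and :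
    ∃ N, ∀ (R V : Type) [CommRing R] (x : List (BoolCircuit V)) (c : BoolCircuit V),
      Derives (areBool R x ∪ isBool R c) (x.length * N) (areBool R (x.map fun a => and a c)) := by
  obtain ⟨N, hN⟩ := exists_derives_isBool (.and (var 0) (var 1) : BoolCircuit (Fin 2))
  refine ⟨N, fun R V _ x c => ?_⟩
  have hbits : Derives (areBool R x ∪ isBool R c) (x.length * N)
      (⋃ i < x.length, isBool R (and (ubit x i) c)) := by
    refine .biUnion_lt fun i _ => (hN R V ![ubit x i, c]).mono_left (Set.iUnion_subset fun j => ?_)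
    refine Set.subset_union_of_subset_left ?_ _
    fin_cases j
    · exact (isBool_ubit_subset x i).trans Set.subset_union_left
    · exact Set.subset_union_right
  rw [map_eq_map_range]
  refine hbits.union_left.mono_right ((areBool_map_range_subset _ _).trans ?_)
  exact Set.union_subset_union_left _
    ((isBool_subset_areBool List.mem_cons_self).trans Set.subset_union_left)

/-- The defect of the `i`-th addition in the shift-and-add product of `x` and `y`. -/
noncomputable def shiftAddDefect (p : ℕ) (x y : List (BoolCircuit V)) (i : ℕ) :
    MvPolynomial V (ZMod p) :=
  VALp p (ADDplus ((PRODplusAux x y i).drop i) (x.map fun a => and a (ubit y i))) -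
    VALp p ((PRODplusAux x y i).drop i) - VALp p (x.map fun a => and a (ubit y i))

theorem VALp_PRODplusAux_sub (p : ℕ) (x y : List (BoolCircuit V)) (m : ℕ) :
    VALp p (PRODplusAux x y m) -
        VALp p x * ∑ i ∈ Finset.range m, C (2 ^ i : ZMod p) * (ubit y i).alg (ZMod p) =
      ∑ i ∈ Finset.range m, C (2 ^ i : ZMod p) * shiftAddDefect p x y i := by
  induction m with
  | zero => simp [PRODplusAux, VALp_replicate_false]
  | succ m ih =>
    have htake : ((PRODplusAux x y m).take m).length = m := by simp [length_PRODplusAux]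
    have hsplit := VALp_append p ((PRODplusAux x y m).take m) ((PRODplusAux x y m).drop m)
    rw [List.take_append_drop, htake] at hsplit
    rw [hsplit] at ih
    rw [Finset.sum_range_succ, Finset.sum_range_succ, ← ih, PRODplusAux, VALp_append, htake,
      shiftAddDefect, VALp_map_and]
    ring

theorem exists_derives_PRODplusAux_succ :
    ∃ N, ∀ (p : ℕ) (V : Type) (x y : List (BoolCircuit V)) (i : ℕ),
      Derives (areBool (ZMod p) x ∪ areBool (ZMod p) y ∪ areBool (ZMod p) (PRODplusAux x y i))
        ((x.length + 1) * N)
        (areBool (ZMod p) (PRODplusAux x y (i + 1)) ∪ {certified (shiftAddDefect p x y i)}) := by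
  obtain ⟨M, hM⟩ := exists_derives_map_and
  obtain ⟨N, hN⟩ := exists_derives_ADDplus
  refine ⟨M + N, fun p V x y i => ?_⟩
  have hand := (hM (ZMod p) V x (ubit y i)).mono_left
    (Set.union_subset_union_right _ (isBool_ubit_subset y i))
  have hadd := hN p V ((PRODplusAux x y i).drop i) (x.map fun a => and a (ubit y i))
  have hlen : max ((PRODplusAux x y i).drop i).length (x.map fun a => and a (ubit y i)).length =
      x.length := by simp [length_PRODplusAux]
  rw [hlen] at hadd
  have hdrop : areBool (ZMod p) ((PRODplusAux x y i).drop i) ⊆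
      areBool (ZMod p) (PRODplusAux x y i) :=
    areBool_mono (List.Subset.trans (List.drop_subset _ _) (List.subset_cons_self _ _))
  have htake : areBool (ZMod p) ((PRODplusAux x y i).take i) ⊆
      areBool (ZMod p) (PRODplusAux x y i) :=
    areBool_mono (List.Subset.trans (List.take_subset _ _) (List.subset_cons_self _ _))
  have h := (hand.mono_left Set.subset_union_left).trans (hadd.mono_left
    (Set.union_subset_union_left _ (hdrop.trans Set.subset_union_right)))
  refine h.union_left.mono subset_rfl (by linarith) (Set.union_subset ?_ ?_)
  · refine (areBool_append_subset _ _).trans (Set.union_subset_union ?_ ?_)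
    · exact htake.trans Set.subset_union_right
    · exact Set.subset_union_left.trans Set.subset_union_right
  · exact (Set.subset_union_right.trans Set.subset_union_right).trans Set.subset_union_right

theorem exists_derives_PRODplus :
    ∃ N, ∀ (p : ℕ) (V : Type) (x y : List (BoolCircuit V)),
      Derives (areBool (ZMod p) x ∪ areBool (ZMod p) y) ((x.length + 1) * (y.length + 1) * N)
        (areBool (ZMod p) (PRODplus x y) ∪
          {certified (VALp p (PRODplus x y) - VALp p x * VALp p y)}) := by
  obtain ⟨N, hN⟩ := exists_derives_PRODplusAux_succ
  refine ⟨N + 1, fun p V x y => ?_⟩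
  let T : ℕ → Set (Line (ZMod p) V) := fun i =>
    areBool (ZMod p) (PRODplusAux x y (i + 1)) ∪ {certified (shiftAddDefect p x y i)}
  have hbits (i : ℕ) :
      areBool (ZMod p) (PRODplusAux x y i) ⊆ areBool (ZMod p) x ∪ ⋃ j < i, T j := by
    cases i with
    | zero =>
      have hzero : PRODplusAux x y 0 ⊆ const false :: x := fun c hc => by
        simp [List.eq_of_mem_replicate hc]
      exact (areBool_mono hzero).trans Set.subset_union_left
    | succ i =>
      exact (Set.subset_union_left.trans (subset_biUnion_lt T i.lt_succ_self)).trans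
        Set.subset_union_right
  have hT : Derives (areBool (ZMod p) x ∪ areBool (ZMod p) y) (y.length * ((x.length + 1) * N))
      (⋃ i < y.length, T i) := by
    refine .biUnion_lt fun i _ => (hN p V x y i).mono_left ?_
    refine Set.union_subset Set.subset_union_left ((hbits i).trans ?_)
    exact Set.union_subset_union_left _ Set.subset_union_left
  have hsum : Derives (⋃ i < y.length, T i) (y.length * (0 + 1) + 1)
      {certified (VALp p (PRODplus x y) - VALp p x * VALp p y)} := by
    rw [PRODplus, VALp_eq_sum p y le_rfl, VALp_PRODplusAux_sub]
    exact .certified_sum _ fun i hi => .of_subset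
      (Set.subset_union_right.trans (subset_biUnion_lt T hi))
  refine (hT.trans (hsum.mono_left Set.subset_union_right)).union_left.mono subset_rfl
    (by nlinarith) (Set.union_subset ((hbits _).trans ?_) ?_)
  · exact Set.union_subset_union Set.subset_union_left Set.subset_union_left
  · exact Set.subset_union_right.trans Set.subset_union_right

end Multiplication

section Constants

theorem getLsbD_ofInt {w i : ℕ} (h : i < w) (a : ℤ) :
    (BitVec.ofInt w a).getLsbD i = a.testBit i := by
  cases a with
  | ofNat n => simp [Int.testBit, BitVec.getLsbD_ofNat, h, -BitVec.getLsbD_eq_getElem]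
  | negSucc n => simp [Int.testBit, BitVec.ofInt_negSucc_eq_not_ofNat, h, BitVec.getLsbD_ofNat,
      -BitVec.getLsbD_eq_getElem]

/-- The carry into position `i` in the addition of two integers. -/
def intCarry (a b : ℤ) : ℕ → Bool
  | 0 => false
  | i + 1 => (a.testBit i).atLeastTwo (b.testBit i) (intCarry a b i)

theorem testBit_add (a b : ℤ) (i : ℕ) :
    (a + b).testBit i = ((a.testBit i ^^ b.testBit i) ^^ intCarry a b i) := by
  have hcarry : ∀ j ≤ i, BitVec.carry j (BitVec.ofInt (i + 1) a) (BitVec.ofInt (i + 1) b) false =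
      intCarry a b j := by
    intro j hj
    induction j with
    | zero => simp [intCarry]
    | succ j ih =>
      rw [BitVec.carry_succ, ih (by omega), getLsbD_ofInt (by omega), getLsbD_ofInt (by omega),
        intCarry]
  have hi : i < i + 1 := by omega
  rw [← getLsbD_ofInt hi, BitVec.ofInt_add, BitVec.getLsbD_add hi, getLsbD_ofInt hi,
    getLsbD_ofInt hi, hcarry i le_rfl, Bool.xor_assoc]

theorem testBit_natCast (n i : ℕ) : (n : ℤ).testBit i = n.testBit i := rfl

theorem testBit_eq_false_of_size_le {n i : ℕ} (h : n.size ≤ i) : n.testBit i = false :=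
  Nat.testBit_lt_two_pow (Nat.size_le.1 h)

theorem testBit_eq_decide_neg {a : ℤ} {i : ℕ} (h : a.natAbs.size ≤ i) :
    a.testBit i = decide (a < 0) := by
  cases a with
  | ofNat n =>
    rw [decide_eq_false (by simp)]
    exact testBit_eq_false_of_size_le h
  | negSucc n =>
    have hn : n.size ≤ i := (Nat.size_le_size n.le_succ).trans h
    simp [Int.testBit, testBit_eq_false_of_size_le hn]

theorem sum_testBit (n b : ℕ) :
    ∑ j ∈ Finset.range b, 2 ^ j * (if n.testBit j then 1 else 0) = n % 2 ^ b := by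
  induction b with
  | zero => simp [Nat.mod_one]
  | succ b ih =>
    rw [Finset.sum_range_succ, ih, Nat.mod_pow_succ, Nat.testBit_eq_decide_div_mod_eq]
    rcases Nat.mod_two_eq_zero_or_one (n / 2 ^ b) with h | h <;> simp [h]

variable {V : Type}

/-- Over every ring, the Boolean circuit `c` is translated to the constant `b`. -/
def HasValue (c : BoolCircuit V) (b : Bool) : Prop :=
  ∀ (R : Type) [CommRing R], c.alg R = if b then 1 else 0

theorem hasValue_const (b : Bool) : HasValue (const b : BoolCircuit V) b := fun _ _ => rfl

namespace HasValue

variable {c d : BoolCircuit V} {a b : Bool}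

theorem not (h : HasValue c b) : HasValue (.not c) (!b) := fun R _ => by
  cases b <;> simp [alg, h R]

theorem and (hc : HasValue c a) (hd : HasValue d b) : HasValue (.and c d) (a && b) := fun R _ => by
  cases a <;> simp [alg, hc R, hd R]

theorem or (hc : HasValue c a) (hd : HasValue d b) : HasValue (.or c d) (a || b) := fun R _ => by
  cases a <;> simp [alg, hc R, hd R]

theorem xor (hc : HasValue c a) (hd : HasValue d b) : HasValue (.xor c d) (a ^^ b) := by
  have h := (hc.and hd.not).or (hc.not.and hd)
  cases a <;> cases b <;> exact h

theorem unique (ha : HasValue c a) (hb : HasValue c b) : a = b := by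
  have h := (ha ℤ).symm.trans (hb ℤ)
  cases a <;> cases b <;> simp_all

end HasValue

/-- The number in two's complement with the bits `x` is the constant `a`. -/
def IntValue (x : List (BoolCircuit V)) (a : ℤ) : Prop :=
  ∀ j, HasValue (sbit x j) (a.testBit j)

/-- The unsigned number with the bits `x` is the constant `n`. -/
def NatValue (x : List (BoolCircuit V)) (n : ℕ) : Prop :=
  ∀ j, HasValue (ubit x j) (n.testBit j)

theorem sbit_eq_ubit {x : List (BoolCircuit V)} {j : ℕ} (h : j < x.length) :
    sbit x j = ubit x j := by
  rw [sbit, ubit, List.getD_eq_getElem _ _ h, List.getD_eq_getElem _ _ h]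

theorem sbit_eq_sign {x : List (BoolCircuit V)} {j : ℕ} (h : x.length ≤ j + 1) :
    sbit x j = sign x := by
  rcases Nat.lt_or_ge j x.length with hj | hj
  · rw [sbit, List.getD_eq_getElem _ _ hj, sign, List.getLastD_eq_getLast?,
      List.getLast?_eq_getElem?, show x.length - 1 = j by omega, List.getElem?_eq_getElem hj]
    rfl
  · rw [sbit, List.getD_eq_default _ _ hj]

theorem sbit_map_range (f : ℕ → BoolCircuit V) (m j : ℕ) :
    sbit ((List.range (m + 1)).map f) j = f (min j m) := by
  rcases Nat.lt_or_ge j (m + 1) with hj | hj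
  · rw [sbit_eq_ubit (by simpa using hj), ubit_map_range f hj, min_eq_left (by omega)]
  · rw [sbit_eq_sign (by simp; omega), sign, List.range_succ, List.map_append, List.map_singleton,
      List.getLastD_concat, min_eq_right (by omega)]

theorem sbit_map {x : List (BoolCircuit V)} (hx : x ≠ []) (f : BoolCircuit V → BoolCircuit V)
    (j : ℕ) : sbit (x.map f) j = f (sbit x j) := by
  obtain ⟨m, hm⟩ := Nat.exists_eq_succ_of_ne_zero (List.length_pos_of_ne_nil hx).ne'
  rw [map_eq_map_range, hm, sbit_map_range]
  rcases Nat.lt_or_ge j (m + 1) with hj | hj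
  · rw [min_eq_left (by omega), sbit_eq_ubit (by omega)]
  · rw [min_eq_right (by omega), ← sbit_eq_ubit (by omega), sbit_eq_sign (j := m) (by omega),
      sbit_eq_sign (by omega)]

namespace IntValue

variable {x y : List (BoolCircuit V)} {a b : ℤ}

theorem hasValue_CARRY (hx : IntValue x a) (hy : IntValue y b) (j : ℕ) :
    HasValue (CARRY x y j) (intCarry a b j) := by
  induction j with
  | zero => exact hasValue_const false
  | succ j ih =>
    have h := ((hx j).and (hy j)).or (((hx j).or (hy j)).and ih)
    rw [CARRY, intCarry]
    convert h using 1
    cases a.testBit j <;> cases b.testBit j <;> simp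

theorem hasValue_sumBit (hx : IntValue x a) (hy : IntValue y b) (j : ℕ) :
    HasValue (sumBit x y j) ((a + b).testBit j) := by
  rw [testBit_add]
  exact ((hx j).xor (hy j)).xor (hx.hasValue_CARRY hy j)

theorem hasValue_sign (hx : IntValue x a) : HasValue (sign x) (decide (a < 0)) := by
  have h := hx (x.length + a.natAbs.size)
  rwa [sbit_eq_sign (by omega), testBit_eq_decide_neg (by omega)] at h

theorem testBit_eq (hx : IntValue x a) {i : ℕ} (hi : x.length ≤ i + 1) :
    a.testBit i = decide (a < 0) :=
  (hx i).unique (by rw [sbit_eq_sign hi]; exact hx.hasValue_sign)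

theorem map_xor {s : BoolCircuit V} {b : Bool} (hx : IntValue x a) (hs : HasValue s b)
    (h0 : x ≠ []) : IntValue (x.map fun c => .xor c s) (if b then a.lnot else a) := by
  intro j
  rw [sbit_map h0]
  have h := (hx j).xor hs
  cases b
  · simpa using h
  · simpa [Int.testBit_lnot] using h

/-- Beyond the lengths of the summands, with the bits also the carries are constant. -/
theorem testBit_add_eq (hx : IntValue x a) (hy : IntValue y b) {j : ℕ}
    (hj : max x.length y.length ≤ j) :
    (a + b).testBit j = (a + b).testBit (max x.length y.length) := by
  set m := max x.length y.length with hm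
  have hstable : (decide (a < 0)).atLeastTwo (decide (b < 0)) (intCarry a b m) =
      intCarry a b m := by
    rcases Nat.eq_zero_or_eq_succ_pred m with h0 | hk
    · obtain rfl : x = [] := List.eq_nil_of_length_eq_zero (by omega)
      obtain rfl : y = [] := List.eq_nil_of_length_eq_zero (by omega)
      rw [hx.hasValue_sign.unique (hasValue_const false),
        hy.hasValue_sign.unique (hasValue_const false)]
      rfl
    · rw [hk, intCarry, hx.testBit_eq (by omega), hy.testBit_eq (by omega)]
      cases decide (a < 0) <;> cases decide (b < 0) <;> simp
  have hcarry : intCarry a b j = intCarry a b m := by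
    induction j, hj using Nat.le_induction with
    | base => rfl
    | succ j hj ih =>
      rw [intCarry, ih, hx.testBit_eq (by omega), hy.testBit_eq (by omega), hstable]
  rw [testBit_add, testBit_add, hcarry, hx.testBit_eq (i := j) (by omega),
    hy.testBit_eq (i := j) (by omega), hx.testBit_eq (by omega), hy.testBit_eq (by omega)]

theorem ADD (hx : IntValue x a) (hy : IntValue y b) : IntValue (ADD x y) (a + b) := by
  intro j
  rw [ADD_eq, sbit_map_range]
  rcases le_total j (max x.length y.length) with h | h
  · rw [min_eq_left h]
    exact hx.hasValue_sumBit hy j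
  · rw [min_eq_right h, hx.testBit_add_eq hy h]
    exact hx.hasValue_sumBit hy _

theorem natValue {n : ℕ} (h : IntValue x n) : NatValue x n := by
  intro j
  rcases Nat.lt_or_ge j x.length with hj | hj
  · rw [← sbit_eq_ubit hj]
    exact h j
  · rw [ubit_of_le hj, ← testBit_natCast, h.testBit_eq (by omega)]
    exact hasValue_const false

end IntValue

theorem intValue_intBits (a : ℤ) : IntValue (intBits a : List (BoolCircuit V)) a := by
  intro j
  rw [intBits, sbit_map_range]
  convert hasValue_const _ using 1
  rcases Nat.lt_or_ge j a.natAbs.size with h | h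
  · rw [min_eq_left h.le]
  · rw [min_eq_right h, testBit_eq_decide_neg h, testBit_eq_decide_neg le_rfl]

theorem natValue_replicate_false (m : ℕ) :
    NatValue (List.replicate m (const false) : List (BoolCircuit V)) 0 := by
  intro j
  have hbit : ubit (List.replicate m (const false : BoolCircuit V)) j = const false := by
    rcases List.mem_cons.1 (ubit_mem (List.replicate m (const false : BoolCircuit V)) j) with h | h
    · exact h
    · exact List.eq_of_mem_replicate h
  rw [hbit, Nat.zero_testBit]
  exact hasValue_const false

namespace NatValue

variable {x y : List (BoolCircuit V)} {m n : ℕ}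

theorem append_false (h : NatValue x n) : IntValue (x ++ [const false]) n := by
  intro j
  rw [sbit_append_false]
  exact h j

theorem testBit_eq_false (h : NatValue x n) {i : ℕ} (hi : x.length ≤ i) : n.testBit i = false :=
  (h i).unique (by rw [ubit_of_le hi]; exact hasValue_const false)

theorem lt_two_pow (h : NatValue x n) {l : ℕ} (hl : x.length ≤ l) : n < 2 ^ l :=
  Nat.lt_pow_two_of_testBit _ fun _ hi => h.testBit_eq_false (hl.trans hi)

theorem of_forall_lt (h : ∀ j < x.length, HasValue (ubit x j) (n.testBit j))
    (hn : n < 2 ^ x.length) : NatValue x n := by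
  intro j
  rcases Nat.lt_or_ge j x.length with hj | hj
  · exact h j hj
  · rw [ubit_of_le hj, Nat.testBit_lt_two_pow (hn.trans_le (Nat.pow_le_pow_right two_pos hj))]
    exact hasValue_const false

theorem ADDplus (hx : NatValue x m) (hy : NatValue y n) : NatValue (ADDplus x y) (m + n) := by
  refine of_forall_lt (fun j hj => ?_) ?_
  · rw [length_ADDplus] at hj
    rw [ADDplus_eq, ubit_map_range _ hj, ← testBit_natCast, Nat.cast_add]
    exact hx.append_false.hasValue_sumBit hy.append_false j
  · have hm := hx.lt_two_pow (le_max_left x.length y.length)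
    have hn := hy.lt_two_pow (le_max_right x.length y.length)
    rw [length_ADDplus, pow_succ]
    omega

theorem drop (hx : NatValue x n) (i : ℕ) : NatValue (x.drop i) (n / 2 ^ i) := by
  intro j
  rw [Nat.testBit_div_two_pow, add_comm]
  simpa [ubit] using hx (i + j)

theorem map_and (hx : NatValue x n) {c : BoolCircuit V} {b : Bool} (hc : HasValue c b) :
    NatValue (x.map fun a => .and a c) (n * b.toNat) := by
  refine of_forall_lt (fun j hj => ?_) ?_
  · rw [List.length_map] at hj
    rw [map_eq_map_range, ubit_map_range _ hj]
    convert (hx j).and hc using 1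
    cases b <;> simp
  · rw [List.length_map]
    have := hx.lt_two_pow le_rfl
    cases b <;> simp [this]

theorem take_append {i : ℕ} (hx : NatValue x m) (hi : i ≤ x.length) (hy : NatValue y n) :
    NatValue (x.take i ++ y) (2 ^ i * n + m % 2 ^ i) := by
  intro j
  have htake : (x.take i).length = i := List.length_take_of_le hi
  rw [Nat.testBit_two_pow_mul_add _ (Nat.mod_lt _ (by positivity))]
  by_cases hj : j < i
  · rw [if_pos hj, Nat.testBit_mod_two_pow, decide_eq_true hj, Bool.true_and, ubit,
      List.getD_append _ _ _ _ (by rwa [htake])]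
    simpa [ubit, List.getElem?_take, hj] using hx j
  · rw [if_neg hj, ubit, List.getD_append_right _ _ _ _ (by rw [htake]; omega), htake]
    exact hy (j - i)

theorem PRODplusAux (hx : NatValue x m) (hy : NatValue y n) (i : ℕ) :
    NatValue (PRODplusAux x y i) (m * (n % 2 ^ i)) := by
  induction i with
  | zero =>
    rw [pow_zero, Nat.mod_one, mul_zero]
    exact natValue_replicate_false _
  | succ i ih =>
    have h := ih.take_append (i := i) (by simp [length_PRODplusAux])
      ((ih.drop i).ADDplus (hx.map_and (hy i)))
    rw [BoolCircuit.PRODplusAux]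
    convert h using 1
    have hmod : n % 2 ^ (i + 1) = n % 2 ^ i + 2 ^ i * (n.testBit i).toNat := by
      rw [Nat.mod_pow_succ, Nat.toNat_testBit]
    rw [hmod]
    linear_combination -Nat.div_add_mod (m * (n % 2 ^ i)) (2 ^ i)

theorem PRODplus (hx : NatValue x m) (hy : NatValue y n) : NatValue (PRODplus x y) (m * n) := by
  have h := hx.PRODplusAux hy y.length
  rwa [Nat.mod_eq_of_lt (hy.lt_two_pow le_rfl)] at h

end NatValue

theorem natValue_singleton {s : BoolCircuit V} {b : Bool} (hs : HasValue s b) :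
    NatValue [s] b.toNat := by
  refine NatValue.of_forall_lt (fun j hj => ?_) b.toNat_lt
  obtain rfl : j = 0 := by simpa using hj
  cases b <;> exact hs

namespace IntValue

variable {x y : List (BoolCircuit V)} {a b : ℤ}

theorem NEGIF {s : BoolCircuit V} {b : Bool} (hx : IntValue x a) (hs : HasValue s b)
    (h0 : x ≠ []) : IntValue (NEGIF s x) (if b then -a else a) := by
  have h : IntValue (BoolCircuit.NEGIF s x) _ :=
    (hx.map_xor hs h0).ADD (natValue_singleton hs).append_false
  convert h using 1
  cases b
  · simp
  · cases a <;> simp [Int.lnot, Int.negSucc_eq]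

theorem ABS (hx : IntValue x a) (h0 : x ≠ []) : NatValue (ABS x) a.natAbs := by
  refine IntValue.natValue ?_
  have h := hx.NEGIF hx.hasValue_sign h0
  rw [BoolCircuit.ABS]
  convert h using 1
  by_cases ha : a < 0 <;> simp [ha] <;> omega

theorem PROD (hx : IntValue x a) (hy : IntValue y b) (hx0 : x ≠ []) (hy0 : y ≠ []) :
    IntValue (PROD x y) (a * b) := by
  have h := ((hx.ABS hx0).PRODplus (hy.ABS hy0)).append_false.NEGIF
    (hx.hasValue_sign.xor hy.hasValue_sign) (by simp)
  rw [BoolCircuit.PROD]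
  convert h using 1
  push_cast
  rcases lt_or_ge a 0 with ha | ha <;> rcases lt_or_ge b 0 with hb | hb <;>
    simp [ha, hb, abs_of_neg, abs_of_nonneg, not_lt.2]

end IntValue

theorem hasValue_sbit_PROD_neg_two_pow {p : ℕ} (hp : 0 < p) (i j : ℕ) :
    HasValue (sbit (PROD (intBits (-2 ^ i)) (intBits p) : List (BoolCircuit V)) j)
      (!(2 ^ i * p - 1).testBit j) := by
  have h := (intValue_intBits (V := V) (-2 ^ i)).PROD (intValue_intBits (p : ℤ))
    (by simp [intBits]) (by simp [intBits]) j
  convert h using 1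
  obtain ⟨m, hm⟩ := Nat.exists_eq_succ_of_ne_zero (show 2 ^ i * p ≠ 0 by positivity)
  have hneg : -2 ^ i * (p : ℤ) = Int.negSucc m := by
    rw [Int.negSucc_eq, neg_mul]
    exact_mod_cast congrArg (fun n : ℕ => -(n : ℤ)) hm
  rw [hneg, hm]
  simp [Int.testBit]

end Constants

section Comparison

open Line

variable {V : Type}

/-- The equivalence of two Boolean circuits. -/
def eqv (a b : BoolCircuit V) : BoolCircuit V := not (xor a b)

/-- If `l` then `a` else `b`, in the form that occurs in a division step. -/
def mux (l a b : BoolCircuit V) : BoolCircuit V := or (and l a) (and (not l) b)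

/-- The comparison of two numbers, given their highest bits `a` and `b` and the comparison `l` of
the remaining bits. -/
def ltStep (a b l : BoolCircuit V) : BoolCircuit V :=
  or (and (not a) b) (and (not (xor a b)) l)

/-- The comparison of the `i` lowest bits of `x` with those of the constant `n`. -/
def ltConst (x : List (BoolCircuit V)) (n i : ℕ) : BoolCircuit V :=
  LTaux x (natBits n.size n) i

theorem ubit_natBits (n j : ℕ) :
    ubit (natBits n.size n : List (BoolCircuit V)) j = const (n.testBit j) := by
  rcases lt_or_ge j n.size with h | h
  · rw [natBits, ubit_map_range _ h]
  · rw [ubit_of_le (by simpa [natBits] using h), Nat.testBit_lt_two_pow (Nat.size_le.1 h)]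

theorem ltConst_zero (x : List (BoolCircuit V)) (n : ℕ) : ltConst x n 0 = const false := rfl

theorem ltConst_succ (x : List (BoolCircuit V)) (n i : ℕ) :
    ltConst x n (i + 1) = ltStep (ubit x i) (const (n.testBit i)) (ltConst x n i) := by
  rw [ltConst, LTaux, ubit_natBits]
  rfl

theorem LTp_eq_ltConst {p i : ℕ} {x : List (BoolCircuit V)} (h : 2 ^ i * p < 2 ^ x.length) :
    LTp p i x = ltConst x (2 ^ i * p) x.length := by
  rw [LTp, BoolCircuit.LT, ltConst]
  congr 1
  simpa [natBits] using Nat.size_le.2 h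

theorem alg_LTp_of_le (R : Type) [CommRing R] {p i : ℕ} {x : List (BoolCircuit V)}
    (h : 2 ^ x.length ≤ 2 ^ i * p) : (LTp p i x).alg R = 1 := by
  obtain ⟨k, hk⟩ := Nat.exists_eq_add_of_lt (Nat.lt_size.2 h)
  have htop : (2 ^ i * p).testBit (x.length + k) = true :=
    Nat.testBit_of_two_pow_le_and_two_pow_add_one_gt (Nat.lt_size.1 (by omega))
      (hk ▸ Nat.lt_size_self _)
  have heq : LTp p i x = ltConst x (2 ^ i * p) (x.length + k + 1) := by
    rw [LTp, BoolCircuit.LT, ltConst]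
    congr 1
    simp only [natBits, List.length_map, List.length_range]
    omega
  rw [heq, ltConst_succ, htop, ubit_of_le (by omega)]
  simp [ltStep, alg]

theorem exists_derives_ltConst :
    ∃ N, ∀ (R V : Type) [CommRing R] (x : List (BoolCircuit V)) (n m : ℕ),
      Derives (areBool R (const true :: x)) (m * N) (allBool R (ltConst x n) m) := by
  obtain ⟨N, hN⟩ := exists_derives_isBool
    (ltStep (var 0) (var 1) (var 2) : BoolCircuit (Fin 3))
  refine ⟨N, fun R V _ x n m => .biUnion_lt fun i _ => ?_⟩
  cases i with
  | zero => exact .of_subset ((isBool_subset_areBool (by simp [ltConst_zero])).trans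
      Set.subset_union_left)
  | succ i =>
    rw [ltConst_succ]
    refine (hN R V ![ubit x i, const (n.testBit i), ltConst x n i]).mono_left
      (Set.iUnion_subset fun j => ?_)
    fin_cases j
    · exact ((isBool_ubit_subset x i).trans (areBool_subset_cons _ x)).trans Set.subset_union_left
    · exact (isBool_const_subset_areBool _ _).trans Set.subset_union_left
    · exact (isBool_subset_allBool (ltConst x n) i.lt_succ_self).trans
        Set.subset_union_right

end Comparison

section Subtraction

open Line

theorem decide_mod_two_pow_succ (m j : ℕ) :
    decide (m % 2 ^ (j + 1) ≠ 0) = (decide (m % 2 ^ j ≠ 0) || m.testBit j) := by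
  rw [Nat.mod_pow_succ, Nat.testBit_eq_decide_div_mod_eq]
  rcases Nat.mod_two_eq_zero_or_one (m / 2 ^ j) with h | h <;> simp [h]

theorem not_testBit_pred {m : ℕ} (hm : 0 < m) (j : ℕ) :
    (!(m - 1).testBit j) = (m.testBit j ^^ decide (m % 2 ^ j ≠ 0)) := by
  have hdm := Nat.div_add_mod m (2 ^ j)
  have hlt := Nat.mod_lt m (Nat.two_pow_pos j)
  have hbit : m.testBit j = (m / 2 ^ j).testBit 0 := by rw [Nat.testBit_div_two_pow, zero_add]
  by_cases hr : m % 2 ^ j = 0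
  · obtain ⟨q, hq⟩ : ∃ q, m / 2 ^ j = q + 1 := Nat.exists_eq_succ_of_ne_zero fun h => by
      rw [h, hr] at hdm
      omega
    have hpred : m - 1 = 2 ^ j * q + (2 ^ j - 1) := by
      rw [hq, hr, mul_add] at hdm
      omega
    rw [hpred, Nat.testBit_two_pow_mul_add _ (by omega), hbit, hq]
    rcases Nat.mod_two_eq_zero_or_one q with h | h <;> simp [hr, Nat.testBit_zero, Nat.add_mod, h]
  · have hpred : m - 1 = 2 ^ j * (m / 2 ^ j) + (m % 2 ^ j - 1) := by omega
    rw [hpred, Nat.testBit_two_pow_mul_add _ (by omega), hbit]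
    simp [hr]

theorem sum_not_testBit_pred {m b : ℕ} (hm : 0 < m) (hb : m < 2 ^ b) :
    ∑ j ∈ Finset.range b, 2 ^ j * (if (!(m - 1).testBit j) then 1 else 0) + m = 2 ^ b := by
  have htestBit := sum_testBit (m - 1) b
  rw [Nat.mod_eq_of_lt (by omega)] at htestBit
  have hcompl : ∑ j ∈ Finset.range b, 2 ^ j * (if (!(m - 1).testBit j) then 1 else 0) +
      ∑ j ∈ Finset.range b, 2 ^ j * (if (m - 1).testBit j then 1 else 0) =
      ∑ j ∈ Finset.range b, 2 ^ j := by
    rw [← Finset.sum_add_distrib]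
    refine Finset.sum_congr rfl fun j _ => ?_
    cases (m - 1).testBit j <;> simp
  have hgeom := Nat.geomSum_eq (m := 2) le_rfl b
  omega

variable {V : Type}

/-- The relation between the carry `c` into a position of the sum of a number `z` and the two's
complement of a number `m`, the comparison `β` of the lower bits of `z` with those of `m`, and
whether `ν` the lower bits of `m` do not all vanish. -/
def carryInv (c β ν : BoolCircuit V) : BoolCircuit V :=
  and (eqv c (and (not β) ν)) (or (not β) ν)

/-- The relation `carryInv` at position `j` of the sum of `x` and the two's complement `y`
of `-m`. -/
def subInv (x y : List (BoolCircuit V)) (m j : ℕ) : BoolCircuit V :=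
  carryInv (CARRY (x ++ [const false]) y j) (ltConst x m j) (const (decide (m % 2 ^ j ≠ 0)))

/-- The bit `s` is that of `x - m` at position `j`. -/
def subBitInv (s : BoolCircuit V) (x : List (BoolCircuit V)) (m j : ℕ) : BoolCircuit V :=
  eqv s (xor (xor (ubit x j) (const (m.testBit j))) (ltConst x m j))

theorem holds_subset_areBool {R : Type} [CommRing R] {c : BoolCircuit V} (hc : c.alg R = 1)
    (x : List (BoolCircuit V)) : holds R c ⊆ areBool R x := by
  rw [holds, hc, sub_self, Set.singleton_subset_iff]
  exact isBool_subset_areBool List.mem_cons_self (.inr (by simp [alg]))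

/-- The bits of `-m` are the complements of those of `m - 1`. -/
theorem HasValue.holds_subset_areBool {m j : ℕ} (hm : 0 < m) {c : BoolCircuit V}
    (hc : HasValue c (!(m - 1).testBit j)) {R : Type} [CommRing R] (x : List (BoolCircuit V)) :
    holds R (eqv c (BoolCircuit.xor (const (m.testBit j)) (const (decide (m % 2 ^ j ≠ 0))))) ⊆
      areBool R x := by
  have h := (hc.xor ((hasValue_const (m.testBit j)).xor
    (hasValue_const (decide (m % 2 ^ j ≠ 0))))).not
  rw [not_testBit_pred hm, Bool.xor_self] at h
  exact BinaryValue.holds_subset_areBool (h R) x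

theorem HasValue.isBool_subset_areBool {c : BoolCircuit V} {b : Bool} (hc : HasValue c b)
    {R : Type} [CommRing R] (x : List (BoolCircuit V)) :
    isBool R c ⊆ areBool R (const true :: x) := by
  rw [isBool, hc R, ← hasValue_const (V := V) b R]
  exact isBool_const_subset_areBool b x

theorem areBool_subset_of_hasValue {R : Type} [CommRing R] {y : List (BoolCircuit V)} {f : ℕ → Bool}
    (hy : ∀ j, HasValue (sbit y j) (f j)) (x : List (BoolCircuit V)) :
    areBool R y ⊆ areBool R (const true :: x) := by
  refine areBool_subset (isBool_const_subset_areBool false x) fun c hc => ?_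
  obtain ⟨j, hj, rfl⟩ := List.mem_iff_getElem.1 hc
  rw [← List.getD_eq_getElem _ (sign y) hj]
  exact (hy j).isBool_subset_areBool x

theorem exists_derives_holds_induction {σ : Type} [Finite σ] (H : List (BoolCircuit σ))
    (c : BoolCircuit σ)
    (hc : ∀ a : σ → Bool, (∀ d ∈ H, truth a d = true) → truth a c = true) :
    ∃ N, ∀ (R V : Type) [CommRing R] (S : Set (Line R V)) (m : ℕ) (w : ℕ → σ → BoolCircuit V)
      (inv : ℕ → BoolCircuit V), holds R (inv 0) ⊆ S →
      (∀ j < m, (inv (j + 1)).alg R = (subst (w j) c).alg R) →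
      (∀ j < m, ∀ i, isBool R (w j i) ⊆ S) →
      (∀ j < m, ∀ d ∈ H, holds R (subst (w j) d) ⊆ S ∪ holds R (inv j)) →
      Derives S ((m + 1) * N) (allHold R inv (m + 1)) := by
  obtain ⟨N, hN⟩ := exists_derives_holds H c hc
  refine ⟨N, fun R V _ S m w inv hzero hsucc hbool hH => .biUnion_lt fun j hj => ?_⟩
  cases j with
  | zero => exact .of_subset (hzero.trans Set.subset_union_left)
  | succ j =>
    have hj : j < m := by omega
    have hprev := holds_subset_allHold (R := R) inv j.lt_succ_self
    rw [holds, hsucc j hj]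
    refine (hN R V (w j)).mono_left (Set.union_subset
      (Set.iUnion_subset fun i => (hbool j hj i).trans Set.subset_union_left)
      (Set.iUnion₂_subset fun d hd => (hH j hj d hd).trans ?_))
    exact Set.union_subset_union_right _ hprev

/-- The circuits on which position `j` of the sum of `x` and the two's complement `y` of `-m`
depends. -/
def subInputs (x y : List (BoolCircuit V)) (m j : ℕ) : Fin 6 → BoolCircuit V :=
  ![ubit x j, const (m.testBit j), const (decide (m % 2 ^ j ≠ 0)), ltConst x m j,
    CARRY (x ++ [const false]) y j, sbit y j]

theorem isBool_subInputs_subset {R : Type} [CommRing R] {x y : List (BoolCircuit V)} {m j n : ℕ}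
    (hy : ∀ j, HasValue (sbit y j) (!(m - 1).testBit j)) (hj : j < n) (i : Fin 6) :
    isBool R (subInputs x y m j i) ⊆ areBool R (const true :: x) ∪
      allBool R (CARRY (x ++ [const false]) y) n ∪ allBool R (ltConst x m) n := by
  have hz := (isBool_ubit_subset (R := R) x j).trans (areBool_subset_cons (const true) x)
  have hm := isBool_const_subset_areBool (R := R) (m.testBit j) x
  have hν := isBool_const_subset_areBool (R := R) (decide (m % 2 ^ j ≠ 0)) x
  have hβ := isBool_subset_allBool (R := R) (ltConst x m) hj
  have hc := isBool_subset_allBool (R := R) (CARRY (x ++ [const false]) y) hj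
  have hd := (hy j).isBool_subset_areBool (R := R) x
  rw [subInputs]
  fin_cases i <;> tauto_set

theorem exists_derives_subInv :
    ∃ N, ∀ (R V : Type) [CommRing R] (x y : List (BoolCircuit V)) (m b : ℕ), 0 < m →
      (∀ j, HasValue (sbit y j) (!(m - 1).testBit j)) →
      Derives (areBool R (const true :: x) ∪
          allBool R (CARRY (x ++ [const false]) y) (b + 1) ∪
          allBool R (ltConst x m) (b + 1)) ((b + 1) * N)
        (allHold R (subInv x y m) (b + 1)) := by
  let z : BoolCircuit (Fin 6) := var 0
  let m : BoolCircuit (Fin 6) := var 1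
  let ν : BoolCircuit (Fin 6) := var 2
  let β : BoolCircuit (Fin 6) := var 3
  let c : BoolCircuit (Fin 6) := var 4
  let d : BoolCircuit (Fin 6) := var 5
  obtain ⟨N, hN⟩ := exists_derives_holds_induction [carryInv c β ν, eqv d (xor m ν)]
    (carryInv (fullCarry z d c) (ltStep z m β) (or ν m)) (by decide +kernel)
  refine ⟨N, fun R V _ x y m b hm hy => hN R V _ b (subInputs x y m) _ ?_ ?_
    (fun j hj => isBool_subInputs_subset hy (Nat.lt_succ_of_lt hj)) fun j hj => ?_⟩
  · refine (holds_subset_areBool ?_ (const true :: x)).trans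
      (Set.subset_union_left.trans Set.subset_union_left)
    simp [subInv, carryInv, eqv, CARRY, BoolCircuit.xor, ltConst_zero, alg, Nat.mod_one]
  · intro j _
    have hν : (const (decide (m % 2 ^ (j + 1) ≠ 0)) : BoolCircuit V).alg R =
        (or (const (decide (m % 2 ^ j ≠ 0))) (const (m.testBit j)) : BoolCircuit V).alg R := by
      rw [decide_mod_two_pow_succ]
      exact (((hasValue_const _).or (hasValue_const _)) R).symm ▸ hasValue_const _ R
    rw [subInv, ltConst_succ, CARRY, sbit_append_false]
    simp only [carryInv, eqv, BoolCircuit.xor, alg] at hν ⊢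
    rw [hν]
    rfl
  · refine List.forall_mem_cons.2 ⟨Set.subset_union_right, List.forall_mem_singleton.2 ?_⟩
    have hd := (hy j).holds_subset_areBool hm (R := R) (const true :: x)
    exact hd.trans (by tauto_set)

theorem exists_derives_subBitInv :
    ∃ N, ∀ (R V : Type) [CommRing R] (x y : List (BoolCircuit V)) (m b : ℕ), 0 < m →
      (∀ j, HasValue (sbit y j) (!(m - 1).testBit j)) →
      Derives (areBool R (const true :: x) ∪
          allBool R (CARRY (x ++ [const false]) y) b ∪
          allBool R (ltConst x m) b ∪ allHold R (subInv x y m) b)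
        (b * N) (allHold R (fun j => subBitInv (sumBit (x ++ [const false]) y j) x m j) b) := by
  let z : BoolCircuit (Fin 6) := var 0
  let m : BoolCircuit (Fin 6) := var 1
  let ν : BoolCircuit (Fin 6) := var 2
  let β : BoolCircuit (Fin 6) := var 3
  let c : BoolCircuit (Fin 6) := var 4
  let d : BoolCircuit (Fin 6) := var 5
  obtain ⟨N, hN⟩ := exists_derives_holds [carryInv c β ν, eqv d (xor m ν)]
    (eqv (xor (xor z d) c) (xor (xor z m) β)) (by decide +kernel)
  refine ⟨N, fun R V _ x y m b hm hy => .biUnion_lt fun j hj => ?_⟩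
  simp only [subBitInv, sumBit, sbit_append_false]
  refine (hN R V (subInputs x y m j)).mono_left (Set.union_subset
    (Set.iUnion_subset fun i => (isBool_subInputs_subset hy hj i).trans (by tauto_set))
    (Set.iUnion₂_subset (List.forall_mem_cons.2 ⟨?_, List.forall_mem_singleton.2 ?_⟩)))
  · have hinv : holds R (subInv x y m j) ⊆ _ :=
      holds_subset_allHold (subInv x y m) hj
    exact hinv.trans (by tauto_set)
  · have hd := (hy j).holds_subset_areBool hm (R := R) (const true :: x)
    exact hd.trans (by tauto_set)

variable (R : Type) [CommRing R]

/-- The correctness of the circuit for `x - m`, with `y` the two's complement of `-m`: its carries,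
its bits and the comparisons of `x` with `m` are Boolean, the carries tell whether `m ≤ x` on the
lower bits, and every bit of the difference is determined by the comparison of the lower bits. -/
def subFacts (x y : List (BoolCircuit V)) (m b : ℕ) : Set (Line R V) :=
  allBool R (CARRY (x ++ [const false]) y) (b + 1) ∪
    allBool R (ltConst x m) (b + 1) ∪ allHold R (subInv x y m) (b + 1) ∪
    allBool R (sumBit (x ++ [const false]) y) b ∪
    allHold R (fun j => subBitInv (sumBit (x ++ [const false]) y j) x m j) b

variable {R} {x y : List (BoolCircuit V)} {m b : ℕ}

theorem allBool_CARRY_subset_subFacts :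
    allBool R (CARRY (x ++ [const false]) y) (b + 1) ⊆ subFacts R x y m b :=
  fun _ h => .inl (.inl (.inl (.inl h)))

theorem allBool_ltConst_subset_subFacts :
    allBool R (ltConst x m) (b + 1) ⊆ subFacts R x y m b :=
  fun _ h => .inl (.inl (.inl (.inr h)))

theorem allHold_subInv_subset_subFacts :
    allHold R (subInv x y m) (b + 1) ⊆ subFacts R x y m b :=
  fun _ h => .inl (.inl (.inr h))

theorem allBool_sumBit_subset_subFacts :
    allBool R (sumBit (x ++ [const false]) y) b ⊆ subFacts R x y m b :=
  fun _ h => .inl (.inr h)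

theorem allHold_subBitInv_subset_subFacts :
    allHold R (fun j => subBitInv (sumBit (x ++ [const false]) y j) x m j) b ⊆
      subFacts R x y m b :=
  fun _ h => .inr h

theorem exists_derives_sub :
    ∃ N, ∀ (R V : Type) [CommRing R] (x y : List (BoolCircuit V)) (m b : ℕ), 0 < m →
      (∀ j, HasValue (sbit y j) (!(m - 1).testBit j)) →
      Derives (areBool R (const true :: x)) ((b + 1) * N) (subFacts R x y m b) := by
  obtain ⟨N₁, hN₁⟩ := exists_derives_CARRY
  obtain ⟨N₂, hN₂⟩ := exists_derives_ltConst
  obtain ⟨N₃, hN₃⟩ := exists_derives_subInv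
  obtain ⟨N₄, hN₄⟩ := exists_derives_subBitInv
  obtain ⟨N₅, hN₅⟩ := exists_derives_sumBit
  refine ⟨N₁ + N₂ + N₃ + N₅ + N₄, fun R V _ x y m b hm hy => ?_⟩
  have hx' : areBool R (x ++ [const false]) ⊆ areBool R (const true :: x) :=
    (areBool_mono (by simp)).trans (areBool_subset_cons _ x)
  have hy' : areBool R y ⊆ areBool R (const true :: x) := areBool_subset_of_hasValue hy x
  have hCARRY := allBool_mono (R := R) (CARRY (x ++ [const false]) y) b.le_succ
  have hltConst := allBool_mono (R := R) (ltConst x m) b.le_succ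
  have hsubInv := allHold_mono (R := R) (subInv x y m) b.le_succ
  have h₁ := (hN₁ R V (x ++ [const false]) y (b + 1)).mono_left (Set.union_subset hx' hy')
  have h₂ := h₁.union (hN₂ R V x m (b + 1))
  have h₃ := hN₃ R V x y m b hm hy
  have h₄ := hN₄ R V x y m b hm hy
  have h₅ := hN₅ R V (x ++ [const false]) y b
  have h := h₂.trans (h₃.mono_left (Set.union_assoc _ _ _).subset)
  have h := h.trans (h₅.mono_left (Set.union_subset
    (Set.union_subset (hx'.trans Set.subset_union_left) (hy'.trans Set.subset_union_left))
    fun _ hφ => .inr (.inl (.inl (hCARRY hφ)))))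
  have h := h.trans (h₄.mono_left (Set.union_subset (Set.union_subset (Set.union_subset
    Set.subset_union_left fun _ hφ => .inr (.inl (.inl (.inl (hCARRY hφ)))))
    fun _ hφ => .inr (.inl (.inl (.inr (hltConst hφ)))))
    fun _ hφ => .inr (.inl (.inr (hsubInv hφ)))))
  exact h.mono_cost (by linarith)

end Subtraction

section ConditionalSubtraction

open Line

variable {V : Type}

/-- If `x < m` then `x`, else the lower bits of `x + y`, where `y` is the two's complement
of `-m`. -/
def condSub (x y : List (BoolCircuit V)) (m : ℕ) : List (BoolCircuit V) :=
  (List.range x.length).map fun j =>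
    mux (ltConst x m x.length) (ubit x j) (sumBit (x ++ [const false]) y j)

theorem exists_derives_condSub :
    ∃ N, ∀ (R V : Type) [CommRing R] (x y : List (BoolCircuit V)) (m : ℕ), 0 < m →
      (∀ j, HasValue (sbit y j) (!(m - 1).testBit j)) →
      Derives (areBool R (const true :: x)) ((x.length + 1) * N)
        (subFacts R x y m x.length ∪ areBool R (const true :: condSub x y m)) := by
  obtain ⟨N₁, hN₁⟩ := exists_derives_sub
  obtain ⟨N₂, hN₂⟩ := exists_derives_isBool (mux (var 0) (var 1) (var 2) : BoolCircuit (Fin 3))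
  refine ⟨N₁ + N₂, fun R V _ x y m hm hy => ?_⟩
  set b := x.length
  set bit : ℕ → BoolCircuit V := fun j =>
    mux (ltConst x m b) (ubit x j) (sumBit (x ++ [const false]) y j)
  have hbits : Derives (areBool R (const true :: x) ∪ subFacts R x y m b) (b * N₂)
      (allBool R bit b) := by
    refine .biUnion_lt fun j hj => (hN₂ R V
      ![ltConst x m b, ubit x j, sumBit (x ++ [const false]) y j]).mono_left
        ((Set.iUnion_subset fun i => ?_).trans Set.subset_union_left)
    have hlt := isBool_subset_allBool (R := R) (ltConst x m) b.lt_succ_self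
    have hx := (isBool_ubit_subset (R := R) x j).trans (areBool_subset_cons (const true) x)
    have hs := isBool_subset_allBool (R := R) (sumBit (x ++ [const false]) y) hj
    fin_cases i
    · exact (hlt.trans allBool_ltConst_subset_subFacts).trans Set.subset_union_right
    · exact hx.trans Set.subset_union_left
    · exact (hs.trans allBool_sumBit_subset_subFacts).trans Set.subset_union_right
  have hx' : areBool R (const true :: condSub x y m) ⊆
      areBool R (const true :: x) ∪ allBool R bit b := by
    have hfalse := isBool_const_subset_areBool (R := R) false x
    have htrue := isBool_const_subset_areBool (R := R) true x
    have hmap := areBool_map_range_subset (R := R) bit b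
    refine areBool_subset (hfalse.trans Set.subset_union_left) (List.forall_mem_cons.2
      ⟨htrue.trans Set.subset_union_left, fun c hc => ?_⟩)
    exact ((isBool_subset_areBool (List.mem_cons_of_mem _ hc)).trans hmap).trans
      (Set.union_subset_union_left _ hfalse)
  have h := ((hN₁ R V x y m b hm hy).trans hbits).union_left
  refine h.mono subset_rfl (by linarith [Nat.zero_le N₂]) (Set.union_subset ?_ (hx'.trans ?_))
  · exact Set.subset_union_left.trans Set.subset_union_right
  · exact Set.union_subset_union_right _ Set.subset_union_right

/-- The relation between the comparisons `l` of `x` with `m`, `k` of `x` with `2 * m` and `r` of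
`x'` with `m`, where `x'` is `x` if `b` holds and `x - m` otherwise. All of them are restricted to
the lowest bits, and `u` is the bit of `2 * m` above these. -/
def compareInv (b l u k r : BoolCircuit V) : BoolCircuit V :=
  and (or (eqv l u) (eqv l k)) (and (or (not b) (eqv r l))
    (or b (eqv r (or (and (not l) u) (and (eqv l u) k)))))

/-- The relation `compareInv` for the lowest `j` bits of `x` and `condSub x y m`. -/
def condSubInv (x y : List (BoolCircuit V)) (m j : ℕ) : BoolCircuit V :=
  compareInv (ltConst x m x.length) (ltConst x m j) (const ((2 * m).testBit j))
    (ltConst x (2 * m) j) (ltConst (condSub x y m) m j)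

/-- The circuits on which position `j` of the relation `condSubInv` depends. -/
def condSubInputs (x y : List (BoolCircuit V)) (m j : ℕ) : Fin 8 → BoolCircuit V :=
  ![ubit x j, const (m.testBit j), const ((2 * m).testBit j), sumBit (x ++ [const false]) y j,
    ltConst x m j, ltConst x (2 * m) j, ltConst (condSub x y m) m j, ltConst x m x.length]

/-- The Booleanity of `x`, the correctness of the subtraction of `m`, and the Booleanity of the
comparisons that occur in `condSubInv`. -/
def condSubFacts (R : Type) [CommRing R] (x y : List (BoolCircuit V)) (m : ℕ) : Set (Line R V) :=
  areBool R (const true :: x) ∪ subFacts R x y m x.length ∪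
    allBool R (ltConst x (2 * m)) (x.length + 1) ∪
    allBool R (ltConst (condSub x y m) m) (x.length + 1)

section

variable {R : Type} [CommRing R] {x y : List (BoolCircuit V)} {m : ℕ}

theorem areBool_subset_condSubFacts : areBool R (const true :: x) ⊆ condSubFacts R x y m :=
  fun _ h => .inl (.inl (.inl h))

theorem subFacts_subset_condSubFacts : subFacts R x y m x.length ⊆ condSubFacts R x y m :=
  fun _ h => .inl (.inl (.inr h))

theorem isBool_ltConst_two_mul_subset_condSubFacts {j : ℕ} (hj : j < x.length + 1) :
    isBool R (ltConst x (2 * m) j) ⊆ condSubFacts R x y m :=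
  fun _ h => .inl (.inr (isBool_subset_allBool _ hj h))

theorem isBool_ltConst_condSub_subset_condSubFacts {j : ℕ} (hj : j < x.length + 1) :
    isBool R (ltConst (condSub x y m) m j) ⊆ condSubFacts R x y m :=
  fun _ h => .inr (isBool_subset_allBool _ hj h)

theorem isBool_condSubInputs_subset {j : ℕ} (hj : j < x.length) (i : Fin 8) :
    isBool R (condSubInputs x y m j i) ⊆ condSubFacts R x y m := by
  have hj' : j < x.length + 1 := hj.trans (Nat.lt_succ_self _)
  have hx := (isBool_ubit_subset (R := R) x j).trans (areBool_subset_cons (const true) x)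
  have hs := (isBool_subset_allBool (R := R) _ hj).trans
    (allBool_sumBit_subset_subFacts (x := x) (y := y) (m := m))
  have hlt {j} (h : j < x.length + 1) : isBool R (ltConst x m j) ⊆ condSubFacts R x y m :=
    ((isBool_subset_allBool _ h).trans allBool_ltConst_subset_subFacts).trans
      subFacts_subset_condSubFacts
  fin_cases i
  · exact hx.trans areBool_subset_condSubFacts
  · exact (isBool_const_subset_areBool _ x).trans areBool_subset_condSubFacts
  · exact (isBool_const_subset_areBool _ x).trans areBool_subset_condSubFacts
  · exact hs.trans subFacts_subset_condSubFacts
  · exact hlt hj'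
  · exact isBool_ltConst_two_mul_subset_condSubFacts hj'
  · exact isBool_ltConst_condSub_subset_condSubFacts hj'
  · exact hlt x.length.lt_succ_self

end

theorem exists_derives_condSubInv :
    ∃ N, ∀ (R V : Type) [CommRing R] (x y : List (BoolCircuit V)) (m : ℕ),
      Derives (condSubFacts R x y m) ((x.length + 1) * N)
        (allHold R (condSubInv x y m) (x.length + 1)) := by
  let z : BoolCircuit (Fin 8) := var 0
  let m : BoolCircuit (Fin 8) := var 1
  let μ : BoolCircuit (Fin 8) := var 2
  let s : BoolCircuit (Fin 8) := var 3
  let l : BoolCircuit (Fin 8) := var 4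
  let k : BoolCircuit (Fin 8) := var 5
  let r : BoolCircuit (Fin 8) := var 6
  let b : BoolCircuit (Fin 8) := var 7
  obtain ⟨N, hN⟩ := exists_derives_holds_induction
    [compareInv b l μ k r, eqv s (xor (xor z m) l)]
    (compareInv b (ltStep z m l) m (ltStep z μ k) (ltStep (mux b z s) m r)) (by decide +kernel)
  refine ⟨N, fun R V _ x y m => hN R V _ x.length (condSubInputs x y m) _ ?_ ?_
    (fun j hj => isBool_condSubInputs_subset hj) fun j hj => ?_⟩
  · refine (holds_subset_areBool ?_ (const true :: x)).trans areBool_subset_condSubFacts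
    simp [condSubInv, compareInv, eqv, BoolCircuit.xor, ltConst_zero, alg]
  · intro j hj
    have hbit : ubit (condSub x y m) j =
        mux (ltConst x m x.length) (ubit x j) (sumBit (x ++ [const false]) y j) :=
      ubit_map_range _ hj
    have htestBit : (2 * m).testBit (j + 1) = m.testBit j := by
      rw [Nat.testBit_succ, Nat.mul_div_cancel_left _ two_pos]
    rw [condSubInv, ltConst_succ, ltConst_succ, ltConst_succ, hbit, htestBit]
    rfl
  · refine List.forall_mem_cons.2 ⟨Set.subset_union_right, List.forall_mem_singleton.2 ?_⟩
    have hs := holds_subset_allHold (R := R)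
      (fun j => subBitInv (sumBit (x ++ [const false]) y j) x m j) hj
    exact ((hs.trans allHold_subBitInv_subset_subFacts).trans subFacts_subset_condSubFacts).trans
      Set.subset_union_left

/-- As `m < 2 ^ x.length`, only the bit `x.length` of `2 * m` is not seen by the comparison with the
bits of `x`; hence the assumption says `x < 2 * m`. -/
theorem exists_derives_ltConst_condSub :
    ∃ N, ∀ (R V : Type) [CommRing R] (x y : List (BoolCircuit V)) (m : ℕ),
      Derives (condSubFacts R x y m ∪ holds R
          (or (const ((2 * m).testBit x.length)) (ltConst x (2 * m) x.length)))
        ((x.length + 1) * N) (holds R (ltConst (condSub x y m) m x.length)) := by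
  let l : BoolCircuit (Fin 4) := var 0
  let u : BoolCircuit (Fin 4) := var 1
  let k : BoolCircuit (Fin 4) := var 2
  let r : BoolCircuit (Fin 4) := var 3
  obtain ⟨N₁, hN₁⟩ := exists_derives_condSubInv
  obtain ⟨N₂, hN₂⟩ := exists_derives_holds [compareInv l l u k r, or u k] r (by decide +kernel)
  refine ⟨N₁ + N₂, fun R V _ x y m => ?_⟩
  set b := x.length
  set w : Fin 4 → BoolCircuit V := ![ltConst x m b, const ((2 * m).testBit b), ltConst x (2 * m) b,
    ltConst (condSub x y m) m b]
  have hw (i : Fin 4) : isBool R (w i) ⊆ condSubFacts R x y m := by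
    fin_cases i
    · exact ((isBool_subset_allBool _ b.lt_succ_self).trans
        allBool_ltConst_subset_subFacts).trans subFacts_subset_condSubFacts
    · exact (isBool_const_subset_areBool _ x).trans areBool_subset_condSubFacts
    · exact isBool_ltConst_two_mul_subset_condSubFacts b.lt_succ_self
    · exact isBool_ltConst_condSub_subset_condSubFacts b.lt_succ_self
  have hinv := holds_subset_allHold (R := R) (condSubInv x y m) b.lt_succ_self
  have h := ((hN₁ R V x y m).mono_left (Set.subset_union_left (t := holds R (or _ _)))).trans
    ((hN₂ R V w).mono_left (Set.union_subset (Set.iUnion_subset fun i => ((hw i).trans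
      Set.subset_union_left).trans Set.subset_union_left) (Set.iUnion₂_subset
      (List.forall_mem_cons.2 ⟨hinv.trans Set.subset_union_right, List.forall_mem_singleton.2
        (Set.subset_union_right.trans Set.subset_union_left)⟩))))
  exact h.mono subset_rfl (by linarith [Nat.zero_le (b * N₂)]) Set.subset_union_right

end ConditionalSubtraction

section ConditionalSubtractionValue

open Line

theorem exists_derives_mux_value :
    ∃ N, ∀ (R V : Type) [CommRing R] (l a b : BoolCircuit V),
      Derives (isBool R l ∪ isBool R a ∪ isBool R b) N
        {certified ((mux l a b).alg R - l.alg R * a.alg R - (1 - l.alg R) * b.alg R)} := by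
  let l : BoolCircuit (Fin 3) := var 0
  let a : BoolCircuit (Fin 3) := var 1
  let b : BoolCircuit (Fin 3) := var 2
  obtain ⟨N, hN⟩ := exists_derives_certified []
    ((mux l a b).alg ℤ - l.alg ℤ * a.alg ℤ - (1 - l.alg ℤ) * b.alg ℤ) fun a _ => by
      simp only [map_sub, map_mul, map_one, eval_boolPoint_alg]
      revert a
      decide
  refine ⟨N, fun R V _ l a b => ?_⟩
  have h := hN R V ![l, a, b]
  simp only [map_sub, map_mul, map_one, ← alg_subst] at h
  refine h.mono_left (Set.union_subset (Set.iUnion_subset fun i => ?_) (by simp))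
  fin_cases i
  · exact Set.subset_union_left.trans Set.subset_union_left
  · exact Set.subset_union_right.trans Set.subset_union_left
  · exact Set.subset_union_right

theorem exists_derives_sum_mux :
    ∃ N, ∀ (R V : Type) [CommRing R] (l : BoolCircuit V) (f g : ℕ → BoolCircuit V) (n : ℕ),
      Derives (isBool R l ∪ allBool R f n ∪ allBool R g n) (n * N + 1)
        {certified (∑ j ∈ Finset.range n, 2 ^ j * (mux l (f j) (g j)).alg R -
          l.alg R * ∑ j ∈ Finset.range n, 2 ^ j * (f j).alg R -
          (1 - l.alg R) * ∑ j ∈ Finset.range n, 2 ^ j * (g j).alg R)} := by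
  obtain ⟨N, hN⟩ := exists_derives_mux_value
  refine ⟨N + 1, fun R V _ l f g n => ?_⟩
  have h := Derives.certified_sum (fun j => (2 ^ j : R)) fun j (hj : j < n) =>
    (hN R V l (f j) (g j)).mono_left (Set.union_subset_union
      (Set.union_subset_union_right _ (isBool_subset_allBool f hj)) (isBool_subset_allBool g hj))
  convert h using 3
  simp only [C_pow, map_ofNat, Finset.mul_sum, ← Finset.sum_sub_distrib]
  exact Finset.sum_congr rfl fun j _ => by ring

theorem exists_derives_carryInv_value :
    ∃ N, ∀ (R V : Type) [CommRing R] (c l : BoolCircuit V),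
      Derives (isBool R c ∪ isBool R l ∪ holds R (carryInv c l (const true))) N
        {certified (c.alg R + l.alg R - 1)} := by
  let c : BoolCircuit (Fin 2) := var 0
  let l : BoolCircuit (Fin 2) := var 1
  obtain ⟨N, hN⟩ := exists_derives_certified [carryInv c l (const true)]
    (c.alg ℤ + l.alg ℤ - 1) fun a ha => by
      simp only [map_sub, map_add, map_one, eval_boolPoint_alg]
      revert a
      decide
  refine ⟨N, fun R V _ c l => ?_⟩
  have h := hN R V ![c, l]
  simp only [map_sub, map_add, map_one, ← alg_subst] at h
  refine h.mono_left (Set.union_subset_union (Set.iUnion_subset fun i => ?_)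
    (Set.iUnion₂_subset (List.forall_mem_singleton.2 subset_rfl)))
  fin_cases i
  · exact Set.subset_union_left
  · exact Set.subset_union_right

variable {R V : Type} [CommRing R]

theorem exists_derives_CARRY_add_ltConst :
    ∃ N, ∀ (R V : Type) [CommRing R] (x y : List (BoolCircuit V)) (m b : ℕ), 0 < m → m < 2 ^ b →
      Derives (subFacts R x y m b) N {certified
        ((CARRY (x ++ [const false]) y b).alg R + (ltConst x m b).alg R - 1)} := by
  obtain ⟨N, hN⟩ := exists_derives_carryInv_value
  refine ⟨N, fun R V _ x y m b hm hlt => (hN R V _ _).mono_left ?_⟩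
  have hν : decide (m % 2 ^ b ≠ 0) = true := by simpa [Nat.mod_eq_of_lt hlt] using hm.ne'
  have hinv := holds_subset_allHold (R := R) (subInv x y m) b.lt_succ_self
  rw [subInv, hν] at hinv
  exact Set.union_subset (Set.union_subset
    ((isBool_subset_allBool _ b.lt_succ_self).trans allBool_CARRY_subset_subFacts)
    ((isBool_subset_allBool _ b.lt_succ_self).trans allBool_ltConst_subset_subFacts))
    (hinv.trans allHold_subInv_subset_subFacts)

/-- Here `l` is the bit `x < m`, `c` the last carry and `s` the value of the lower bits of the
difference, `v` and `v'` are the values of `x` and of the selected number, and `T = 2 ^ b` for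
numbers of `b` bits. -/
theorem derives_certified_select {S : Set (Line R V)} {n : ℕ} {l c s v v' : MvPolynomial V R}
    (T : R) (hl : Derives S n {computed l}) (hl2 : Derives S n {certified (l ^ 2 - l)})
    (hsum : Derives S n {certified (s + C T * c - v - C T)})
    (hcarry : Derives S n {certified (c + l - 1)})
    (hselect : Derives S n {certified (v' - l * v - (1 - l) * s)}) :
    Derives S (7 * (n + 1)) {certified (v' - v)} := by
  have hdiff := hsum.certified_lin 1 (-T) hcarry
  have hcompl := hdiff.certified_lin 1 (-1) (hl.certified_mul hdiff)
  have h := ((hselect.certified_add hcompl).certified_lin 1 (-T) hl2).mono_cost (m := 7 * (n + 1))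
    (by omega)
  convert h using 3
  simp only [C_neg, C_1]
  ring

theorem sum_two_pow_mul_alg_sbit {y : List (BoolCircuit V)} {m b : ℕ} (hm : 0 < m)
    (hlt : m < 2 ^ b) (hmR : (m : R) = 0)
    (hy : ∀ j, HasValue (sbit y j) (!(m - 1).testBit j)) :
    ∑ j ∈ Finset.range b, 2 ^ j * (sbit y j).alg R = C (2 ^ b) := by
  have h := congrArg (Nat.cast : ℕ → R) (sum_not_testBit_pred hm hlt)
  push_cast at h
  rw [hmR, add_zero] at h
  rw [← h, map_sum]
  refine Finset.sum_congr rfl fun j _ => ?_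
  rw [hy j R, C_mul, C_pow, map_ofNat]
  split_ifs <;> simp

theorem exists_derives_VALp_condSub :
    ∃ N, ∀ (p : ℕ) (V : Type) (x y : List (BoolCircuit V)) (m : ℕ), 0 < m → m < 2 ^ x.length →
      (m : ZMod p) = 0 → (∀ j, HasValue (sbit y j) (!(m - 1).testBit j)) →
      Derives (areBool (ZMod p) (const true :: x) ∪ subFacts (ZMod p) x y m x.length)
        ((x.length + 1) * N) {certified (VALp p (condSub x y m) - VALp p x)} := by
  obtain ⟨N₁, hN₁⟩ := exists_derives_sum_sumBit
  obtain ⟨N₂, hN₂⟩ := exists_derives_CARRY_add_ltConst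
  obtain ⟨N₃, hN₃⟩ := exists_derives_sum_mux
  refine ⟨7 * (N₁ + N₂ + N₃ + 2), fun p V x y m hm hlt hm0 hy => ?_⟩
  set b := x.length
  set n := b * N₁ + b * N₃ + N₂ + 1 with hn
  set S := areBool (ZMod p) (const true :: x) ∪ subFacts (ZMod p) x y m b
  have hx : areBool (ZMod p) (const true :: x) ⊆ S := Set.subset_union_left
  have hsub : subFacts (ZMod p) x y m b ⊆ S := Set.subset_union_right
  have hltConst : isBool (ZMod p) (ltConst x m b) ⊆ S := ((isBool_subset_allBool _
    b.lt_succ_self).trans allBool_ltConst_subset_subFacts).trans hsub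
  have hsum := (hN₁ (ZMod p) V (x ++ [const false]) y b).mono (Set.union_subset
    (Set.union_subset (((areBool_mono (by simp)).trans (areBool_subset_cons _ x)).trans hx)
      ((areBool_subset_of_hasValue hy x).trans hx))
    (((allBool_mono _ b.le_succ).trans allBool_CARRY_subset_subFacts).trans hsub))
    (show _ ≤ n by omega) subset_rfl
  have hcarry := (hN₂ (ZMod p) V x y m b hm hlt).mono hsub (show _ ≤ n by omega) subset_rfl
  have hselect := (hN₃ (ZMod p) V (ltConst x m b) (ubit x) (sumBit (x ++ [const false]) y) b).mono
    (Set.union_subset (Set.union_subset hltConst (Set.iUnion₂_subset fun j _ =>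
      ((isBool_ubit_subset x j).trans (areBool_subset_cons _ x)).trans hx))
      (allBool_sumBit_subset_subFacts.trans hsub)) (show _ ≤ n by omega) subset_rfl
  have hvalue : VALp p x = ∑ j ∈ Finset.range b, 2 ^ j * (ubit x j).alg (ZMod p) := by
    simp only [VALp, C_pow, map_ofNat, b]
  have hvalue' : VALp p (condSub x y m) = ∑ j ∈ Finset.range b, 2 ^ j *
      (mux (ltConst x m b) (ubit x j) (sumBit (x ++ [const false]) y j)).alg (ZMod p) := by
    rw [condSub, VALp_map_range]
    simp only [C_pow, map_ofNat, b]
  simp only [sum_two_pow_mul_alg_sbit hm hlt hm0 hy, sbit_append_false, ← hvalue, ← hvalue']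
    at hsum hselect
  refine (derives_certified_select (2 ^ b : ZMod p) (.of_subset ?_) (.of_subset ?_) ?_ hcarry
    hselect).mono_cost (by nlinarith)
  · exact (Set.singleton_subset_iff.2 (.inl rfl)).trans hltConst
  · exact (Set.singleton_subset_iff.2 (.inr rfl)).trans hltConst
  · rwa [C_pow, map_ofNat] at hsum ⊢

end ConditionalSubtractionValue

section DivisionStep

open Line

variable {V : Type}

theorem length_REMstep (p i : ℕ) (x : List (BoolCircuit V)) :
    (REMstep p i x).length = x.length := by
  simp [REMstep]

theorem REMstep_eq_condSub {p i : ℕ} {x : List (BoolCircuit V)} (h : 2 ^ i * p < 2 ^ x.length) :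
    REMstep p i x = condSub x (PROD (intBits (-2 ^ i)) (intBits p)) (2 ^ i * p) := by
  refine List.map_congr_left fun j hj => ?_
  have hj : j < x.length := List.mem_range.1 hj
  rw [LTp_eq_ltConst h, SUBPROD, ADD_eq, sbit_map_range, min_eq_left]
  · rfl
  · simp only [List.length_append, List.length_singleton]
    omega

theorem alg_REMstep_of_le (R : Type) [CommRing R] {p i : ℕ} {x : List (BoolCircuit V)}
    (h : 2 ^ x.length ≤ 2 ^ i * p) (a b : BoolCircuit V) :
    (mux (LTp p i x) a b).alg R = a.alg R := by
  simp [mux, alg, alg_LTp_of_le R h]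

theorem areBool_REMstep_subset_of_le {R : Type} [CommRing R] {p i : ℕ} {x : List (BoolCircuit V)}
    (h : 2 ^ x.length ≤ 2 ^ i * p) : areBool R (REMstep p i x) ⊆ areBool R x := by
  refine areBool_subset (isBool_subset_areBool List.mem_cons_self) fun c hc => ?_
  obtain ⟨j, -, rfl⟩ := List.mem_map.1 hc
  have hj := alg_REMstep_of_le R h (ubit x j) (sbit (SUBPROD p x i) j)
  rw [mux] at hj
  rw [isBool, hj]
  exact isBool_ubit_subset x j

theorem VALp_REMstep_of_le {p i : ℕ} {x : List (BoolCircuit V)} (h : 2 ^ x.length ≤ 2 ^ i * p) :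
    VALp p (REMstep p i x) = VALp p x := by
  rw [REMstep, VALp_map_range]
  exact Finset.sum_congr rfl fun j _ => congrArg _ (alg_REMstep_of_le (ZMod p) h _ _)

theorem holds_ltConst_two_mul_subset {R : Type} [CommRing R] {p i : ℕ} {x : List (BoolCircuit V)}
    (h : 2 ^ i * p < 2 ^ x.length) :
    holds R (or (const ((2 * (2 ^ i * p)).testBit x.length)) (ltConst x (2 * (2 ^ i * p)) x.length))
      ⊆ areBool R x ∪ holds R (LTp p (i + 1) x) := by
  have hpow : 2 ^ (i + 1) * p = 2 * (2 ^ i * p) := by ring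
  rcases lt_or_ge (2 * (2 ^ i * p)) (2 ^ x.length) with hlt | hge
  · rw [LTp_eq_ltConst (hpow ▸ hlt), hpow, Nat.testBit_lt_two_pow hlt]
    simp [holds, alg]
  · rw [Nat.testBit_of_two_pow_le_and_two_pow_add_one_gt hge (by rw [pow_succ]; omega)]
    exact (holds_subset_areBool (by simp [alg]) x).trans Set.subset_union_left

/-- The bits `x'` are certified to be Boolean and to have the same value modulo `p` as `x`, and
`l` is certified to hold. -/
def reducesTo (p : ℕ) (x x' : List (BoolCircuit V)) (l : BoolCircuit V) :
    Set (Line (ZMod p) V) :=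
  areBool (ZMod p) x' ∪ holds (ZMod p) l ∪ {certified (VALp p x' - VALp p x)}

theorem derives_reducesTo_trans {p : ℕ} {x x' x'' : List (BoolCircuit V)} {l l' : BoolCircuit V} :
    Derives (reducesTo p x x' l ∪ reducesTo p x' x'' l') 1 (reducesTo p x x'' l') := by
  have h : Derives (reducesTo p x x' l ∪ reducesTo p x' x'' l') 1
      {certified (VALp p x'' - VALp p x)} := by
    rw [← sub_add_sub_cancel _ (VALp p x')]
    exact Derives.certified_add (m := 0) (n := 0)
      (.of_subset (Set.singleton_subset_iff.2 (.inr (.inr rfl))))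
      (.of_subset (Set.singleton_subset_iff.2 (.inl (.inr rfl))))
  refine h.union_left.mono_right (Set.union_subset_union_left _ ?_)
  exact Set.subset_union_left.trans Set.subset_union_right

theorem exists_derives_reducesTo_condSub :
    ∃ N, ∀ (p : ℕ) (V : Type) (x y : List (BoolCircuit V)) (m : ℕ), 0 < m → m < 2 ^ x.length →
      (m : ZMod p) = 0 → (∀ j, HasValue (sbit y j) (!(m - 1).testBit j)) →
      Derives (areBool (ZMod p) (const true :: x) ∪ holds (ZMod p)
          (or (const ((2 * m).testBit x.length)) (ltConst x (2 * m) x.length)))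
        ((x.length + 1) * N)
        (reducesTo p x (condSub x y m) (ltConst (condSub x y m) m x.length)) := by
  obtain ⟨N₁, hN₁⟩ := exists_derives_condSub
  obtain ⟨N₂, hN₂⟩ := exists_derives_ltConst
  obtain ⟨N₃, hN₃⟩ := exists_derives_ltConst_condSub
  obtain ⟨N₄, hN₄⟩ := exists_derives_VALp_condSub
  refine ⟨N₁ + (N₂ + N₂) + (N₃ + N₄), fun p V x y m hm hlt hm0 hy => ?_⟩
  set b := x.length
  have hsub := (hN₁ (ZMod p) V x y m hm hy).mono_left (Set.subset_union_left (t := holds (ZMod p)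
    (or (const ((2 * m).testBit b)) (ltConst x (2 * m) b))))
  have hcomp := hsub.trans (((hN₂ (ZMod p) V x (2 * m) (b + 1)).mono_left
    fun _ h => .inl (.inl h)).union ((hN₂ (ZMod p) V (condSub x y m) m (b + 1)).mono_left
      fun _ h => .inr (.inr h)))
  have hvalue := hcomp.trans (((hN₃ (ZMod p) V x y m).mono_left ?_).union
    ((hN₄ p V x y m hm hlt hm0 hy).mono_left ?_))
  · refine hvalue.mono subset_rfl (by linarith) (Set.union_subset (Set.union_subset ?_ ?_) ?_)
    · exact (areBool_subset_cons _ _).trans fun _ h => .inl (.inl (.inr h))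
    · exact fun _ h => .inr (.inl h)
    · exact fun _ h => .inr (.inr h)
  · rintro φ ((((h | h) | h) | h) | h)
    exacts [.inl (.inl h), .inr (.inl (.inl h)), .inr (.inr (.inl h)), .inr (.inr (.inr h)),
      .inl (.inr h)]
  · exact Set.union_subset (fun _ h => .inl (.inl h)) fun _ h => .inr (.inl (.inl h))

theorem exists_derives_REMstep :
    ∃ N, ∀ (p : ℕ) [NeZero p] (V : Type) (x : List (BoolCircuit V)) (i : ℕ),
      Derives (areBool (ZMod p) x ∪ holds (ZMod p) (LTp p (i + 1) x)) ((x.length + 1) * N)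
        (reducesTo p x (REMstep p i x) (LTp p i (REMstep p i x))) := by
  obtain ⟨N, hN⟩ := exists_derives_reducesTo_condSub
  refine ⟨N + 2, fun p _ V x i => ?_⟩
  have hm : 0 < 2 ^ i * p := mul_pos (by positivity) (NeZero.pos p)
  rcases lt_or_ge (2 ^ i * p) (2 ^ x.length) with hlt | hge
  · have hlen : 2 ^ i * p < 2 ^ (REMstep p i x).length := by rwa [length_REMstep]
    rw [LTp_eq_ltConst hlen, length_REMstep, REMstep_eq_condSub hlt]
    have h := (derives_isBool_const _ true).trans ((hN p V x _ (2 ^ i * p) hm hlt (by simp)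
      (hasValue_sbit_PROD_neg_two_pow (NeZero.pos p) i)).mono_left (Set.union_subset
        ((areBool_cons_subset _ x).trans (Set.union_subset Set.subset_union_right
          (Set.subset_union_left.trans Set.subset_union_left)))
        ((holds_ltConst_two_mul_subset hlt).trans Set.subset_union_left)))
    exact h.mono subset_rfl (by nlinarith) Set.subset_union_right
  · have hle : 2 ^ (REMstep p i x).length ≤ 2 ^ i * p := by rwa [length_REMstep]
    rw [reducesTo, VALp_REMstep_of_le hge, sub_self]
    have hzero := (Step.zero (S := areBool (ZMod p) x ∪ holds _ (LTp p (i + 1) x))).derives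
    refine hzero.union_left.mono subset_rfl (by nlinarith) (Set.union_subset_union_left _ ?_)
    exact (Set.union_subset (areBool_REMstep_subset_of_le hge)
      (holds_subset_areBool (alg_LTp_of_le _ hle) x)).trans Set.subset_union_left

end DivisionStep

section Remainder

open Line

variable {V : Type}

theorem length_REMiter (p : ℕ) (x : List (BoolCircuit V)) (i : ℕ) :
    (REMiter p x i).length = x.length := by
  induction i with
  | zero => rfl
  | succ i ih => rw [REMiter, length_REMstep, ih]

theorem exists_derives_REMiter :
    ∃ N, ∀ (p : ℕ) [NeZero p] (V : Type) (x : List (BoolCircuit V)) (i : ℕ), i ≤ x.length →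
      Derives (areBool (ZMod p) x) (i * ((x.length + 1) * N + 1) + 1)
        (reducesTo p x (REMiter p x i) (LTp p (x.length - i) (REMiter p x i))) := by
  obtain ⟨N, hN⟩ := exists_derives_REMstep
  refine ⟨N, fun p _ V x i hi => ?_⟩
  induction i with
  | zero =>
    have hlt : (LTp p x.length x).alg (ZMod p) = 1 :=
      alg_LTp_of_le _ (Nat.le_mul_of_pos_right _ (NeZero.pos p))
    rw [reducesTo, REMiter, Nat.sub_zero, sub_self, zero_mul, zero_add]
    exact Step.zero.derives.union_left.mono_right (Set.union_subset_union_left _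
      (Set.union_subset subset_rfl (holds_subset_areBool hlt x)))
  | succ i ih =>
    have hprev := ih (Nat.le_of_succ_le hi)
    have hstep := hN p V (REMiter p x i) (x.length - (i + 1))
    rw [show x.length - (i + 1) + 1 = x.length - i by omega, length_REMiter] at hstep
    have h := (hprev.trans (hstep.mono_left ?_)).trans (derives_reducesTo_trans.mono_left
      Set.subset_union_right)
    · exact h.mono subset_rfl (by linarith) Set.subset_union_right
    · exact Set.subset_union_left.trans Set.subset_union_right

theorem ltConst_succ_of_size_le {n c : ℕ} (x : List (BoolCircuit V)) (hc : n.size ≤ c) :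
    ltConst x n (c + 1) = ltStep (ubit x c) (const false) (ltConst x n c) := by
  rw [ltConst_succ, Nat.testBit_lt_two_pow (Nat.size_le.1 hc)]

theorem iUnion_isBool_ubit_ltConst_subset {R : Type} [CommRing R] (x : List (BoolCircuit V))
    {n b c : ℕ} (hc : c < b) :
    ⋃ i, isBool R (![ubit x c, ltConst x n c] i) ⊆
      areBool R (const true :: x) ∪ allBool R (ltConst x n) b := by
  refine Set.iUnion_subset fun i => ?_
  fin_cases i
  · exact ((isBool_ubit_subset x c).trans (areBool_subset_cons _ x)).trans Set.subset_union_left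
  · exact (isBool_subset_allBool _ hc).trans Set.subset_union_right

theorem exists_derives_allHold_ltConst :
    ∃ N, ∀ (R V : Type) [CommRing R] (x : List (BoolCircuit V)) (n k : ℕ),
      Derives (areBool R (const true :: x) ∪ allBool R (ltConst x n) (n.size + k) ∪
          holds R (ltConst x n (n.size + k))) ((k + 1) * N)
        (allHold R (fun j => ltConst x n (n.size + k - j)) (k + 1)) := by
  obtain ⟨N, hN⟩ := exists_derives_holds_induction
    [ltStep (var 0 : BoolCircuit (Fin 2)) (const false) (var 1)] (var 1) (by decide +kernel)
  refine ⟨N, fun R V _ x n k => hN R V _ k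
    (fun j => ![ubit x (n.size + k - (j + 1)), ltConst x n (n.size + k - (j + 1))])
    (fun j => ltConst x n (n.size + k - j)) Set.subset_union_right (fun _ _ => rfl)
    (fun j hj => Set.iUnion_subset_iff.1 ((iUnion_isBool_ubit_ltConst_subset x (by omega)).trans
      Set.subset_union_left)) fun j hj => List.forall_mem_singleton.2 ?_⟩
  rw [show n.size + k - j = n.size + k - (j + 1) + 1 by omega,
    ltConst_succ_of_size_le x (by omega)]
  exact Set.subset_union_right

theorem exists_derives_ubit_of_ltConst :
    ∃ N, ∀ (R V : Type) [CommRing R] (x : List (BoolCircuit V)) (n b c : ℕ), n.size ≤ c → c < b →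
      Derives (areBool R (const true :: x) ∪ allBool R (ltConst x n) b ∪
        holds R (ltConst x n (c + 1))) N {certified ((ubit x c).alg R)} := by
  obtain ⟨N, hN⟩ := exists_derives_certified
    [ltStep (var 0 : BoolCircuit (Fin 2)) (const false) (var 1)] (X 0) fun a ha => by
      have hbit : a 0 = false := by
        revert a
        decide
      simp [boolPoint, hbit]
  refine ⟨N, fun R V _ x n b c hc hcb => ?_⟩
  have h := hN R V ![ubit x c, ltConst x n c]
  rw [aeval_X] at h
  rw [ltConst_succ_of_size_le x hc]
  exact h.mono_left (Set.union_subset_union (iUnion_isBool_ubit_ltConst_subset x hcb)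
    (Set.iUnion₂_subset (List.forall_mem_singleton.2 subset_rfl)))

theorem exists_derives_sum_high_bits :
    ∃ N, ∀ (R V : Type) [CommRing R] (x : List (BoolCircuit V)) (n k : ℕ) (a : ℕ → R),
      Derives (areBool R (const true :: x) ∪ holds R (ltConst x n (n.size + k)))
        ((n.size + k + 1) * N)
        {certified (∑ j ∈ Finset.range k, C (a j) * (ubit x (n.size + j)).alg R)} := by
  obtain ⟨N₁, hN₁⟩ := exists_derives_ltConst
  obtain ⟨N₂, hN₂⟩ := exists_derives_allHold_ltConst
  obtain ⟨N₃, hN₃⟩ := exists_derives_ubit_of_ltConst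
  refine ⟨N₁ + N₂ + N₃ + 1, fun R V _ x n k a => ?_⟩
  set b := n.size + k with hb
  have hbool := (hN₁ R V x n b).mono_left
    (Set.subset_union_left (t := holds R (ltConst x n b)))
  have hholds := hbool.trans ((hN₂ R V x n k).mono_left (Set.union_subset (Set.union_subset
    (fun _ h => .inl (.inl h)) Set.subset_union_right) fun _ h => .inl (.inr h)))
  have hsum := hholds.trans (.certified_sum a fun j (hj : j < k) =>
    (hN₃ R V x n b (n.size + j) (by omega) (by omega)).mono_left (Set.union_subset
      (Set.union_subset (fun _ h => .inl (.inl h)) fun _ h => .inr (.inl h)) ?_))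
  · refine hsum.mono subset_rfl ?_ Set.subset_union_right
    nlinarith [Nat.zero_le (n.size * N₂), Nat.zero_le (n.size * N₃)]
  · have h := holds_subset_allHold (R := R) (fun j => ltConst x n (b - j))
      (show k - 1 - j < k + 1 by omega)
    simp only [show b - (k - 1 - j) = n.size + j + 1 by omega] at h
    exact h.trans fun _ h => .inr (.inr h)

theorem areBool_REM_subset {R : Type} [CommRing R] (p : ℕ) (x : List (BoolCircuit V)) :
    areBool R (REM p x) ⊆ areBool R (REMiter p x x.length) :=
  areBool_mono fun c hc => by
    obtain ⟨j, -, rfl⟩ := List.mem_map.1 hc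
    exact ubit_mem _ j

theorem VALp_REM_sub {p : ℕ} {x : List (BoolCircuit V)} (h : p.size ≤ x.length) :
    VALp p (REM p x) - VALp p x = VALp p (REMiter p x x.length) - VALp p x -
      ∑ j ∈ Finset.range (x.length - p.size), C (2 ^ (p.size + j) : ZMod p) *
        (ubit (REMiter p x x.length) (p.size + j)).alg (ZMod p) := by
  rw [VALp_eq_sum p (REMiter p x x.length) (m := p.size + (x.length - p.size))
    (by rw [length_REMiter]; omega), Finset.sum_range_add, REM, VALp_map_range]
  ring

theorem exists_derives_REM :
    ∃ N, ∀ (p : ℕ) [NeZero p] (V : Type) (x : List (BoolCircuit V)), p.size ≤ x.length →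
      Derives (areBool (ZMod p) x) ((x.length + 1) ^ 2 * N)
        (areBool (ZMod p) (REM p x) ∪ {certified (VALp p (REM p x) - VALp p x)}) := by
  obtain ⟨N₁, hN₁⟩ := exists_derives_REMiter
  obtain ⟨N₂, hN₂⟩ := exists_derives_sum_high_bits
  refine ⟨N₁ + N₂ + 5, fun p _ V x hsize => ?_⟩
  obtain ⟨k, hk⟩ := Nat.exists_eq_add_of_le hsize
  set y := REMiter p x x.length
  have hy : y.length = x.length := length_REMiter p x _
  have hlt : LTp p (x.length - x.length) y = ltConst y p (p.size + k) := by
    rw [Nat.sub_self, LTp_eq_ltConst, pow_zero, one_mul, hy, hk]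
    rw [pow_zero, one_mul, hy]
    exact Nat.size_le.1 hsize
  have hiter := (derives_isBool_const _ true).union (hN₁ p V x x.length le_rfl)
  rw [hlt] at hiter
  have hhigh := hiter.trans ((hN₂ (ZMod p) V y p k fun j => 2 ^ (p.size + j)).mono_left
    (Set.union_subset ((areBool_cons_subset _ y).trans (Set.union_subset
      (fun _ h => .inr (.inl h)) fun _ h => .inr (.inr (.inl (.inl h)))))
      fun _ h => .inr (.inr (.inl (.inr h)))))
  have hval := hhigh.trans (.certified_lin (m := 0) (n := 0) 1 (-1)
    (.of_subset (Set.singleton_subset_iff.2 (.inr (.inl (.inr (.inr rfl))))))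
    (.of_subset (Set.singleton_subset_iff.2 (.inr (.inr rfl)))))
  refine hval.mono subset_rfl ?_ (Set.union_subset ?_ ?_)
  · rw [← hk]
    nlinarith [Nat.zero_le (x.length * N₁), Nat.zero_le (x.length * N₂),
      Nat.zero_le (x.length ^ 2 * N₂)]
  · exact (areBool_REM_subset p x).trans fun _ h => .inl (.inl (.inr (.inl (.inl h))))
  · rw [VALp_REM_sub hsize, Nat.sub_eq_of_eq_add' hk, sub_eq_add_neg]
    refine Set.subset_union_right.trans' (Set.singleton_subset_singleton.2 ?_)
    simp [y]

end Remainder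

section BitExtraction

open Line

variable {V : Type}

/-- The bits `x` are certified to be Boolean, the polynomial `f` is computed, and `f` is certified
to be the value modulo `p` of `x`. -/
def represents (p : ℕ) (f : MvPolynomial V (ZMod p)) (x : List (BoolCircuit V)) :
    Set (Line (ZMod p) V) :=
  areBool (ZMod p) x ∪ {computed f, certified (f - VALp p x)}

theorem length_constBits (p : ℕ) (α : ZMod p) :
    (constBits p α : List (BoolCircuit V)).length = p.size := by
  simp [constBits, natBits]

theorem length_varBits (p : ℕ) {n : ℕ} (i : Fin n) : (varBits p i).length = p.size := by
  simp [varBits]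

theorem length_REM (p : ℕ) (x : List (BoolCircuit V)) : (REM p x).length = p.size := by
  simp [REM]

theorem length_scaleBits {p : ℕ} (α : ZMod p) {x : List (BoolCircuit V)} (hx : x.length = p.size) :
    (scaleBits p α x).length = p.size := by
  rw [scaleBits]
  split
  · exact hx
  · exact length_REM p _

theorem length_linBits {p : ℕ} :
    ∀ {l : List (ZMod p × List (BoolCircuit V))}, (∀ e ∈ l, e.2.length = p.size) →
      (linBits p l).length = p.size
  | [], _ => length_constBits p 0
  | [e], h => length_scaleBits e.1 (h e List.mem_cons_self)
  | _ :: _ :: _, _ => length_REM p _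

theorem length_gate_BITp {p n k : ℕ} {B : Fin k → List (BoolCircuit (Fin n × Fin p.size))}
    (hB : ∀ u, (B u).length = p.size) (f : Fin k → MvPolynomial (Fin n) (ZMod p))
    (g : Gate (ZMod p) (Fin n) k) : (g.BITp B f).length = p.size := by
  cases g with
  | var i => exact length_varBits p i
  | const α => exact length_constBits p α
  | mul u w => exact length_REM p _
  | lin l => exact length_linBits (List.forall_mem_map.2 fun e _ => hB e.2)
  | inv u => exact length_constBits p _

theorem length_gates_BITp {p n k : ℕ} (c : Gates (ZMod p) (Fin n) k) (u : Fin k) :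
    (c.BITp u).length = p.size := by
  induction c with
  | nil => exact u.elim0
  | snoc c g ih =>
    induction u using Fin.lastCases with
    | cast u => simpa only [Gates.BITp, Fin.snoc_castSucc] using ih u
    | last => simpa only [Gates.BITp, Fin.snoc_last] using length_gate_BITp ih c.poly g

theorem VALp_constBits {p : ℕ} [NeZero p] (α : ZMod p) :
    VALp p (constBits p α : List (BoolCircuit V)) = C α := by
  have hsum := congrArg (Nat.cast : ℕ → MvPolynomial V (ZMod p)) (sum_testBit α.val p.size)
  rw [Nat.mod_eq_of_lt ((ZMod.val_lt α).trans (Nat.lt_size_self p)), Nat.cast_sum,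
    ← map_natCast C, ZMod.natCast_zmod_val] at hsum
  rw [constBits, natBits, VALp_map_range, ← hsum]
  exact Finset.sum_congr rfl fun j _ => by
    rw [C_pow, map_ofNat]
    simp [alg]

theorem derives_represents_VALp (p : ℕ) (x : List (BoolCircuit V)) :
    Derives (areBool (ZMod p) x) (x.length + 2) (represents p (VALp p x) x) := by
  have hval : Derives (areBool (ZMod p) x) (x.length * (0 + 1) + 1) {computed (VALp p x)} :=
    .computed_sum _ fun i _ => .of_subset
      ((Set.singleton_subset_iff.2 (.inl rfl)).trans (isBool_ubit_subset x i))
  rw [represents, sub_self, Set.insert_eq]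
  exact (hval.union Step.zero.derives).union_left.mono_cost (by omega)

theorem derives_represents_const {p : ℕ} [NeZero p] (S : Set (Line (ZMod p) V)) (α : ZMod p) :
    Derives S (p.size + 6) (represents p (C α) (constBits p α)) := by
  have hbits : Derives S 4 (areBool (ZMod p) (constBits p α)) :=
    ((derives_isBool_const S false).union (derives_isBool_const S true)).mono_right <|
      areBool_subset Set.subset_union_left fun c hc => by
        obtain ⟨j, -, rfl⟩ := List.mem_map.1 hc
        cases α.val.testBit j
        exacts [Set.subset_union_left, Set.subset_union_right]
  have hval := derives_represents_VALp p (constBits p α : List (BoolCircuit V))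
  rw [VALp_constBits, length_constBits] at hval
  exact (hbits.trans (hval.mono_left Set.subset_union_right)).mono subset_rfl (by omega)
    Set.subset_union_right

theorem areBool_subset_allBool_ubit (R : Type) [CommRing R] (x : List (BoolCircuit V)) :
    areBool R x ⊆ isBool R (const false) ∪ allBool R (ubit x) x.length := by
  refine areBool_subset Set.subset_union_left fun c hc => ?_
  obtain ⟨i, hi, rfl⟩ := List.getElem_of_mem hc
  rw [← show ubit x i = x[i] by simp [ubit, hi]]
  exact (isBool_subset_allBool (ubit x) hi).trans Set.subset_union_right

theorem derives_isBool_var {R : Type} [CommRing R] (S : Set (Line R V)) (v : V) :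
    Derives S 2 (isBool R (var v)) :=
  (Step.var v).derives.union (Step.axm v).derives

theorem derives_represents_var {p n : ℕ} (S : Set (Line (ZMod p) (Fin n × Fin p.size)))
    (i : Fin n) :
    Derives S (3 * p.size + 4) (represents p (VALp p (varBits p i)) (varBits p i)) := by
  have hbits : Derives S (2 + p.size * 2)
      (isBool (ZMod p) (const false) ∪ allBool (ZMod p) (ubit (varBits p i)) p.size) := by
    refine (derives_isBool_const S false).union (.biUnion_lt fun j hj => ?_)
    have hvar : ubit (varBits p i) j = var (i, ⟨j, hj⟩) := by
      simp [ubit, varBits, hj]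
    rw [hvar]
    exact derives_isBool_var _ _
  have hval := derives_represents_VALp p (varBits p i)
  have hsubset := areBool_subset_allBool_ubit (ZMod p) (varBits p i)
  rw [length_varBits] at hval hsubset
  exact (hbits.trans (hval.mono_left (hsubset.trans Set.subset_union_right))).mono subset_rfl
    (by omega) Set.subset_union_right

theorem exists_derives_ADDp :
    ∃ N, ∀ (p : ℕ) [NeZero p] (V : Type) (x y : List (BoolCircuit V)),
      x.length = p.size → y.length = p.size →
      Derives (areBool (ZMod p) x ∪ areBool (ZMod p) y) ((p.size + 1) ^ 2 * N)
        (areBool (ZMod p) (ADDp p x y) ∪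
          {certified (VALp p (ADDp p x y) - (VALp p x + VALp p y))}) := by
  obtain ⟨N₁, hN₁⟩ := exists_derives_ADDplus
  obtain ⟨N₂, hN₂⟩ := exists_derives_REM
  refine ⟨N₁ + 4 * N₂ + 1, fun p _ V x y hx hy => ?_⟩
  have hlen : (ADDplus x y).length = p.size + 1 := by rw [length_ADDplus, hx, hy, max_self]
  have hadd := hN₁ p V x y
  have hrem := hN₂ p V (ADDplus x y) (by omega)
  rw [hx, hy, max_self] at hadd
  rw [hlen] at hrem
  have h := (hadd.trans (hrem.mono_left fun _ h => .inr (.inl h))).trans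
    (.certified_add (m := 0) (n := 0)
      (.of_subset (Set.singleton_subset_iff.2 (.inr (.inr (.inr rfl)))))
      (.of_subset (Set.singleton_subset_iff.2 (.inr (.inl (.inr rfl))))))
  rw [sub_sub, sub_add_sub_cancel] at h
  refine h.mono subset_rfl ?_ (Set.union_subset_union_left _ fun _ h => .inr (.inl h))
  nlinarith [Nat.zero_le (p.size * N₁), Nat.zero_le (p.size * N₂), Nat.zero_le (p.size ^ 2 * N₁),
    Nat.zero_le (p.size ^ 2 * N₂)]

theorem exists_derives_PRODp :
    ∃ N, ∀ (p : ℕ) [NeZero p] (V : Type) (x y : List (BoolCircuit V)),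
      x.length = p.size → y.length = p.size →
      Derives (areBool (ZMod p) x ∪ areBool (ZMod p) y) ((p.size + 1) ^ 2 * N)
        (areBool (ZMod p) (PRODp p x y) ∪
          {certified (VALp p (PRODp p x y) - VALp p x * VALp p y)}) := by
  obtain ⟨N₁, hN₁⟩ := exists_derives_PRODplus
  obtain ⟨N₂, hN₂⟩ := exists_derives_REM
  refine ⟨N₁ + 4 * N₂ + 1, fun p _ V x y hx hy => ?_⟩
  have hlen : (PRODplus x y).length = p.size + p.size := by rw [length_PRODplus, hx, hy]
  have hprod := hN₁ p V x y
  have hrem := hN₂ p V (PRODplus x y) (by omega)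
  rw [hx, hy] at hprod
  rw [hlen] at hrem
  have h := (hprod.trans (hrem.mono_left fun _ h => .inr (.inl h))).trans
    (.certified_add (m := 0) (n := 0)
      (.of_subset (Set.singleton_subset_iff.2 (.inr (.inr (.inr rfl)))))
      (.of_subset (Set.singleton_subset_iff.2 (.inr (.inl (.inr rfl))))))
  rw [sub_add_sub_cancel] at h
  refine h.mono subset_rfl ?_ (Set.union_subset_union_left _ fun _ h => .inr (.inl h))
  nlinarith [Nat.zero_le (p.size * N₁), Nat.zero_le (p.size * N₂), Nat.zero_le (p.size ^ 2 * N₂)]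

theorem areBool_union_subset_represents (p : ℕ) (f g : MvPolynomial V (ZMod p))
    (x y : List (BoolCircuit V)) :
    areBool (ZMod p) x ∪ areBool (ZMod p) y ⊆ represents p f x ∪ represents p g y :=
  Set.union_subset_union Set.subset_union_left Set.subset_union_left

theorem exists_derives_represents_add :
    ∃ N, ∀ (p : ℕ) [NeZero p] (V : Type) (f g : MvPolynomial V (ZMod p))
      (x y : List (BoolCircuit V)), x.length = p.size → y.length = p.size →
      Derives (represents p f x ∪ represents p g y) ((p.size + 1) ^ 2 * N)
        (represents p (f + g) (ADDp p x y)) := by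
  obtain ⟨N, hN⟩ := exists_derives_ADDp
  refine ⟨N + 3, fun p _ V f g x y hx hy => ?_⟩
  set S := represents p f x ∪ represents p g y
  have hbits := (hN p V x y hx hy).mono_left (areBool_union_subset_represents p f g x y)
  have hcomputed : Derives S 1 {computed (f + g)} := .computed_add (m := 0) (n := 0)
    (.of_subset (Set.singleton_subset_iff.2 (.inl (.inr (.inl rfl)))))
    (.of_subset (Set.singleton_subset_iff.2 (.inr (.inr (.inl rfl)))))
  have hvalue : Derives S 1 {certified ((f - VALp p x) + (g - VALp p y))} :=
    .certified_add (m := 0) (n := 0)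
      (.of_subset (Set.singleton_subset_iff.2 (.inl (.inr (.inr rfl)))))
      (.of_subset (Set.singleton_subset_iff.2 (.inr (.inr (.inr rfl)))))
  have hcertified := (hcomputed.union (hvalue.union hbits)).trans
    (.certified_lin (m := 0) (n := 0) 1 (-1)
      (.of_subset (Set.singleton_subset_iff.2 (.inr (.inr (.inl rfl)))))
      (.of_subset (Set.singleton_subset_iff.2 (.inr (.inr (.inr (.inr rfl)))))))
  refine hcertified.mono subset_rfl ?_ (Set.union_subset ?_ (Set.insert_subset ?_ ?_))
  · nlinarith [Nat.zero_le (p.size ^ 2)]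
  · exact fun _ h => .inl (.inr (.inr (.inl h)))
  · exact .inl (.inl rfl)
  · refine Set.singleton_subset_iff.2 (.inr (congrArg certified ?_))
    simp only [C_neg, C_1]
    ring

theorem exists_derives_represents_mul :
    ∃ N, ∀ (p : ℕ) [NeZero p] (V : Type) (f g : MvPolynomial V (ZMod p))
      (x y : List (BoolCircuit V)), x.length = p.size → y.length = p.size →
      Derives (represents p f x ∪ represents p g y) ((p.size + 1) ^ 2 * N)
        (represents p (f * g) (PRODp p x y)) := by
  obtain ⟨N, hN⟩ := exists_derives_PRODp
  refine ⟨N + 7, fun p _ V f g x y hx hy => ?_⟩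
  set S := represents p f x ∪ represents p g y
  have hbits := (hN p V x y hx hy).mono_left (areBool_union_subset_represents p f g x y)
  have hf : Derives S 0 {computed f} :=
    .of_subset (Set.singleton_subset_iff.2 (.inl (.inr (.inl rfl))))
  have hg : Derives S 0 {computed g} :=
    .of_subset (Set.singleton_subset_iff.2 (.inr (.inr (.inl rfl))))
  have hfx : Derives S 0 {certified (f - VALp p x)} :=
    .of_subset (Set.singleton_subset_iff.2 (.inl (.inr (.inr rfl))))
  have hgy : Derives S 0 {certified (g - VALp p y)} :=
    .of_subset (Set.singleton_subset_iff.2 (.inr (.inr (.inr rfl))))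
  have hx : Derives S 2 {computed (C 1 * f + C (-1) * (f - VALp p x))} :=
    hf.computed_lin 1 (-1) (Step.weaken (.inl (.inr (.inr rfl)))).derives
  have hvalue := (hg.certified_mul hfx).certified_add (hx.certified_mul hgy)
  have hcertified := ((hf.computed_mul hg).union (hvalue.union hbits)).trans
    (.certified_lin (m := 0) (n := 0) 1 (-1)
      (.of_subset (Set.singleton_subset_iff.2 (.inr (.inr (.inl rfl)))))
      (.of_subset (Set.singleton_subset_iff.2 (.inr (.inr (.inr (.inr rfl)))))))
  refine hcertified.mono subset_rfl ?_ (Set.union_subset ?_ (Set.insert_subset ?_ ?_))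
  · nlinarith [Nat.zero_le (p.size ^ 2)]
  · exact fun _ h => .inl (.inr (.inr (.inl h)))
  · exact .inl (.inl rfl)
  · refine Set.singleton_subset_iff.2 (.inr (congrArg certified ?_))
    simp only [C_neg, C_1]
    ring

theorem exists_derives_represents_scale :
    ∃ N, ∀ (p : ℕ) [NeZero p] (V : Type) (α : ZMod p) (f : MvPolynomial V (ZMod p))
      (x : List (BoolCircuit V)), x.length = p.size →
      Derives (represents p f x) ((p.size + 1) ^ 2 * N)
        (represents p (C α * f) (scaleBits p α x)) := by
  obtain ⟨N, hN⟩ := exists_derives_represents_mul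
  refine ⟨N + 6, fun p _ V α f x hx => ?_⟩
  rw [scaleBits]
  split_ifs with hα
  · rw [hα, C_1, one_mul]
    exact .of_subset subset_rfl
  · have h := (derives_represents_const (represents p f x) α).trans
      ((hN p V (C α) f (constBits p α) x (length_constBits p α) hx).mono_left
        (Set.union_comm _ _).subset)
    exact h.mono subset_rfl (by nlinarith [Nat.zero_le (p.size ^ 2)]) Set.subset_union_right

theorem exists_derives_represents_lin :
    ∃ N, ∀ (p : ℕ) [NeZero p] (V K : Type) (f : K → MvPolynomial V (ZMod p))
      (x : K → List (BoolCircuit V)) (l : List (ZMod p × K)), (∀ u, (x u).length = p.size) →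
      Derives (⋃ u, represents p (f u) (x u)) ((p.size + 1) ^ 2 * N * (l.length + 1))
        (represents p (l.map fun e => C e.1 * f e.2).sum
          (linBits p (l.map fun e => (e.1, x e.2)))) := by
  obtain ⟨N₁, hN₁⟩ := exists_derives_represents_add
  obtain ⟨N₂, hN₂⟩ := exists_derives_represents_scale
  refine ⟨N₁ + N₂ + 6, fun p _ V K f x l hx => ?_⟩
  have hscale (e : ZMod p × K) := (hN₂ p V e.1 (f e.2) (x e.2) (hx e.2)).mono_left
    (Set.subset_iUnion (fun u => represents p (f u) (x u)) e.2)
  induction l with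
  | nil =>
    have h := derives_represents_const (⋃ u, represents p (f u) (x u)) 0
    rw [C_0] at h
    exact h.mono_cost (by nlinarith [Nat.zero_le ((p.size + 1) ^ 2 * (N₁ + N₂))])
  | cons e l ih =>
    cases l with
    | nil =>
      simp only [List.map_cons, List.map_nil, List.sum_singleton]
      refine (hscale e).mono_cost ?_
      nlinarith [Nat.zero_le ((p.size + 1) ^ 2 * N₁), Nat.zero_le ((p.size + 1) ^ 2 * N₂)]
    | cons e' l =>
      have hlin := length_linBits (l := (e' :: l).map fun e => (e.1, x e.2))
        (List.forall_mem_map.2 fun e _ => hx e.2)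
      have h := ((hscale e).union ih).trans ((hN₁ p V _ _ _ _ (length_scaleBits e.1 (hx e.2))
        hlin).mono_left Set.subset_union_right)
      refine h.mono subset_rfl ?_ Set.subset_union_right
      rw [List.length_cons (a := e), mul_add _ _ 1]
      nlinarith [Nat.zero_le ((p.size + 1) ^ 2)]

end BitExtraction

section Gates

theorem inverse_mem_range_C {R V : Type} [CommRing R] {f : MvPolynomial V R}
    (hf : f ∈ (C : R →+* MvPolynomial V R).range) (hunit : IsUnit f) :
    Ring.inverse f ∈ (C : R →+* MvPolynomial V R).range := by
  obtain ⟨a, rfl⟩ := hf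
  obtain ⟨u, rfl⟩ : IsUnit a := by simpa using hunit.map constantCoeff
  exact ⟨↑u⁻¹, (Ring.inverse_unit (Units.map (C : R →+* MvPolynomial V R).toMonoidHom u)).symm⟩

theorem poly_mem_range_C_of_synConst {R V : Type} [CommRing R] {k : ℕ} {c : Gates R V k}
    (hc : c.Admissible) {u : Fin k} (hu : c.SynConst u) :
    c.poly u ∈ (C : R →+* MvPolynomial V R).range := by
  induction c with
  | nil => exact u.elim0
  | snoc c g ih =>
    induction u using Fin.lastCases with
    | cast u =>
      simp only [Gates.SynConst, Fin.snoc_castSucc] at hu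
      simpa only [Gates.poly, Fin.snoc_castSucc] using ih hc.1 hu
    | last =>
      simp only [Gates.SynConst, Fin.snoc_last] at hu
      simp only [Gates.poly, Fin.snoc_last]
      cases g with
      | var v => exact hu.elim
      | const a => exact ⟨a, rfl⟩
      | mul u w => exact mul_mem (ih hc.1 hu.1) (ih hc.1 hu.2)
      | lin l =>
        exact list_sum_mem
          (List.forall_mem_map.2 fun e he => mul_mem ⟨e.1, rfl⟩ (ih hc.1 (hu e he)))
      | inv u => exact inverse_mem_range_C (ih hc.1 hu) hc.2.2

theorem length_succ_le_bitSize_lin {p k : ℕ} {V : Type} (l : List (ZMod p × Fin k)) :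
    l.length + 1 ≤ (Gate.lin l : Gate (ZMod p) V k).bitSize := by
  have h := List.length_le_sum_of_one_le (l.map fun e => 1 + e.1.val.size)
    (List.forall_mem_map.2 fun _ _ => Nat.le_add_right _ _)
  rw [List.length_map] at h
  rw [Gate.bitSize]
  omega

/-- The substitution `x_i ↦ VAL_p(BIT_p(x_i))` on polynomials. -/
noncomputable def substBits (p n : ℕ) :
    MvPolynomial (Fin n) (ZMod p) →ₐ[ZMod p] MvPolynomial (Fin n × Fin p.size) (ZMod p) :=
  aeval fun i => VALp p (varBits p i)

theorem substBits_C {p n : ℕ} (a : ZMod p) : substBits p n (C a) = C a :=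
  aeval_C _ a

/-- Every gate of `c` is represented by the bits extracted from it. -/
def representsGates {p n k : ℕ} (c : Gates (ZMod p) (Fin n) k) :
    Set (Line (ZMod p) (Fin n × Fin p.size)) :=
  ⋃ u, represents p (substBits p n (c.poly u)) (c.BITp u)

theorem represents_subset_representsGates {p n k : ℕ} (c : Gates (ZMod p) (Fin n) k) (u : Fin k) :
    represents p (substBits p n (c.poly u)) (c.BITp u) ⊆ representsGates c :=
  Set.subset_iUnion (fun u => represents p (substBits p n (c.poly u)) (c.BITp u)) u

theorem exists_derives_gate :
    ∃ N, ∀ (p : ℕ) [NeZero p] (n k : ℕ) (c : Gates (ZMod p) (Fin n) k)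
      (g : Gate (ZMod p) (Fin n) k),
      c.Admissible → g.Admissible c →
      Derives (representsGates c) ((p.size + 1) ^ 2 * N * g.bitSize)
        (represents p (substBits p n (g.poly c.poly)) (g.BITp c.BITp c.poly)) := by
  obtain ⟨N₁, hN₁⟩ := exists_derives_represents_mul
  obtain ⟨N₂, hN₂⟩ := exists_derives_represents_lin
  refine ⟨N₁ + N₂ + 6, fun p _ n k c g hc hg => ?_⟩
  have hle : p.size + 6 ≤ (p.size + 1) ^ 2 * (N₁ + N₂ + 6) := by
    nlinarith [Nat.zero_le (p.size ^ 2), Nat.zero_le ((p.size + 1) ^ 2 * (N₁ + N₂))]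
  have hconst (a : ZMod p) {r : ℕ} (hr : 1 ≤ r) :=
    (derives_represents_const (representsGates c) a).mono_cost
      (hle.trans (Nat.le_mul_of_pos_right _ hr))
  cases g with
  | var i =>
    rw [Gate.poly, substBits, aeval_X]
    refine (derives_represents_var _ i).mono_cost ?_
    rw [Gate.bitSize]
    nlinarith [Nat.zero_le (p.size ^ 2), Nat.zero_le ((p.size + 1) ^ 2 * (N₁ + N₂))]
  | const a =>
    rw [Gate.poly, substBits_C]
    exact hconst a (Nat.le_add_right _ _)
  | mul u w =>
    rw [Gate.poly, map_mul]
    refine (hN₁ p _ _ _ _ _ (length_gates_BITp c u) (length_gates_BITp c w)).mono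
      (Set.union_subset (represents_subset_representsGates c u)
        (represents_subset_representsGates c w)) ?_ subset_rfl
    rw [Gate.bitSize]
    nlinarith [Nat.zero_le ((p.size + 1) ^ 2 * N₁), Nat.zero_le ((p.size + 1) ^ 2 * N₂)]
  | lin l =>
    have h := hN₂ p _ _ (fun u => substBits p n (c.poly u)) c.BITp l (length_gates_BITp c)
    rw [Gate.poly, map_list_sum, List.map_map, Gate.BITp]
    simp only [Function.comp_def, map_mul, substBits_C]
    exact h.mono_cost (Nat.mul_le_mul (by gcongr; omega) (length_succ_le_bitSize_lin l))
  | inv u =>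
    obtain ⟨a, ha⟩ := inverse_mem_range_C (poly_mem_range_C_of_synConst hc hg.1) hg.2
    rw [Gate.poly, Gate.BITp, ← ha, substBits_C, constantCoeff_C]
    exact hconst a (Nat.le_add_right _ _)

theorem exists_derives_gates :
    ∃ N, ∀ (p : ℕ) [NeZero p] (n k : ℕ) (c : Gates (ZMod p) (Fin n) k), c.Admissible →
      Derives ∅ ((p.size + 1) ^ 2 * N * c.bitSize) (representsGates c) := by
  obtain ⟨N, hN⟩ := exists_derives_gate
  refine ⟨N, fun p _ n k c hc => ?_⟩
  induction c with
  | nil => exact .of_subset (Set.iUnion_subset fun u => u.elim0)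
  | snoc c g ih =>
    have h := (ih hc.1).trans ((hN p n _ c g hc.1 hc.2).mono_left Set.subset_union_right)
    rw [Gates.bitSize, mul_add]
    refine h.mono_right (Set.iUnion_subset fun u => ?_)
    induction u using Fin.lastCases with
    | cast u =>
      simp only [Gates.poly, Gates.BITp, Fin.snoc_castSucc]
      exact (represents_subset_representsGates c u).trans Set.subset_union_left
    | last =>
      simp only [Gates.poly, Gates.BITp, Fin.snoc_last]
      exact Set.subset_union_right

theorem size_le_log_add_one (p : ℕ) : p.size ≤ Nat.log 2 p + 1 :=
  Nat.size_le.2 (Nat.lt_pow_succ_log_self one_lt_two p)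

end Gates

end BinaryValue

theorem mainTheorem4_general :
    ∃ Q : Polynomial ℕ, ∀ (p : ℕ) [NeZero p] (n : ℕ) (F : AlgCircuit (ZMod p) (Fin n)),
      ∃ P : AlgCircuit (ZMod p) ((Fin n × Fin p.size) ⊕ (Fin n × Fin p.size)),
        IsIPSProof P (boolAxiom (ZMod p) (Fin n × Fin p.size))
          (MvPolynomial.aeval (fun i => BoolCircuit.VALp p (varBits p i)) F.poly
            - BoolCircuit.VALp p F.BITp) ∧
        P.bitSize ≤ Q.eval (F.bitSize + Nat.log 2 p) := by
  obtain ⟨N, hN⟩ := BinaryValue.exists_derives_gates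
  refine ⟨(Polynomial.X + 2) ^ 2 * Polynomial.C N * Polynomial.X * (2 * Polynomial.X + 5),
    fun p _ n F => ?_⟩
  have hout := (hN p n F.numGates F.gates F.admissible).mono_right
    (T' := {.certified (BinaryValue.substBits p n F.poly - BoolCircuit.VALp p F.BITp)})
    (Set.singleton_subset_iff.2 (Set.mem_iUnion.2 ⟨F.out, .inr (.inr rfl)⟩))
  obtain ⟨P, hP, hsize⟩ := hout.exists_isIPSProof
  refine ⟨P, hP, hsize.trans ?_⟩
  have hp := BinaryValue.size_le_log_add_one p
  simp only [Polynomial.eval_add, Polynomial.eval_mul, Polynomial.eval_pow, Polynomial.eval_C,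
    Polynomial.eval_X, Polynomial.eval_ofNat, AlgCircuit.bitSize]
  gcongr ?_ ^ 2 * N * ?_ * ?_ <;> omega

theorem mainTheorem4 :
    ∃ Q : Polynomial ℕ, ∀ (p : ℕ) [Fact p.Prime] (n : ℕ) (F : AlgCircuit (ZMod p) (Fin n)),
      ∃ P : AlgCircuit (ZMod p) ((Fin n × Fin p.size) ⊕ (Fin n × Fin p.size)),
        IsIPSProof P (boolAxiom (ZMod p) (Fin n × Fin p.size))
          (MvPolynomial.aeval (fun i => BoolCircuit.VALp p (varBits p i)) F.poly
            - BoolCircuit.VALp p F.BITp) ∧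
        P.bitSize ≤ Q.eval (F.bitSize + Nat.log 2 p) :=
  mainTheorem4_general.imp fun _ hQ p _ => hQ p
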